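/- Theorem (Width of the multiset ordering). Let $X$ be a well partial order (wpo), i.e. a partial order such that every infinite sequence $(x_i)_{i\in\mathbb N}$ in $X$ has $x_i\le x_j$ for some $i<j$. Then $$\mathbf{w}(M^{r}(X))=\omega^{\underline{\mathbf{o}}(X)},$$ with the following notation. For a wpo $Y$, the maximal order type $\mathbf{o}(Y)$ (respectively the width $\mathbf{w}(Y)$) is the rank of the empty sequence in the well-founded tree of finite sequences $y_1,\dots,y_n$ in $Y$ with $y_i\not\le y_j$ for all $i<j$ (respectively with $y_i\perp y_j$, i.e. $y_i\not\le y_j$ and $y_j\not\le y_i$, for all $i<j$); here the rank of a sequence is the least ordinal strictly larger than the ranks of all its proper extensions in the tree. A subset of $X$ carries the induced order. $M^{r}(X)$ is the set of finite multisets over $X$ with the multiset ordering: $m\le_r m'$ if and only if $m=m'$ or for every $x\in m\setminus(m\cap m')$ there is $y\in m'\setminus(m\cap m')$ with $x<y$, where $\cap$ and $\setminus$ are the intersection and the difference of multisets. It is again a wpo. A subset $X'\subseteq X$ is safe if there is a maximal linearisation of $X'$, i.e. a monotone bijection $\ell$ from $X'$ onto the set of ordinals smaller than $\mathbf{o}(X')$,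 such that for all $n\ge 0$, all $x_1,\dots,x_n\in X'$ and all $x\in X'$ with $\ell(x)<\ell(x_i)$ for every $i$, there is $z\in X$ with $z\perp x$ and $z\not\ge x_i$ for every $i$. The maximal safe order type of $X$ is the ordinal $\underline{\mathbf{o}}(X)=\sup\{\mathbf{o}(X') : X'\subseteq X \text{ safe}\}$. -/

import Mathlib

open scoped Ordinal

universe u

/-! ### Trees of finite sequences and their ranks -/

/-- The tree of finite sequences `x₁, …, xₙ` of elements of `X` such that `R xᵢ xⱼ` for all
`i < j`. -/
@[ext]
structure SeqTree {X : Type u} (R : X → X → Prop) : Type u where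
  /-- The underlying finite sequence. -/
  toList : List X
  pairwise : toList.Pairwise R

namespace SeqTree

variable {X : Type u} {R : X → X → Prop}

/-- The empty sequence, which is the root of the tree. -/
def root (R : X → X → Prop) : SeqTree R :=
  ⟨[], List.Pairwise.nil⟩

/-- Strict inverse prefix order: `s.Extends t` means that `t` is a proper prefix of `s`. -/
def Extends (s t : SeqTree R) : Prop :=
  t.toList <+: s.toList ∧ t ≠ s

theorem wellFounded_extends (h : ∀ f : ℕ → X, ∃ m n, m < n ∧ ¬ R (f m) (f n)) :
    WellFounded (Extends (R := R)) := by
  rw [wellFounded_iff_isEmpty_descending_chain]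
  refine ⟨fun ⟨s, hs⟩ => ?_⟩
  have hpre : ∀ m n, m ≤ n → (s m).toList <+: (s n).toList := by
    intro m n hmn
    induction n, hmn using Nat.le_induction with
    | base => exact List.prefix_rfl
    | succ n _ ih => exact ih.trans (hs n).1
  have hlen : ∀ n, n ≤ (s n).toList.length := by
    intro n
    induction n with
    | zero => exact Nat.zero_le _
    | succ n ih =>
      have h1 := (hs n).1.length_le
      have h2 : (s n).toList.length ≠ (s (n + 1)).toList.length := fun e =>
        (hs n).2 (SeqTree.ext ((hs n).1.eq_of_length e))
      omega
  obtain ⟨m, n, hmn, hR⟩ := h fun n => (s (n + 1)).toList[n]'(hlen (n + 1))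
  have hn := hlen (n + 1)
  apply hR
  have e := (hpre (m + 1) (n + 1) (by omega)).getElem (hlen (m + 1))
  simp only [e]
  exact List.pairwise_iff_getElem.1 (s (n + 1)).pairwise m n (by omega) (by omega) hmn

/-- The rank of the empty sequence, where the rank of a sequence is the least ordinal strictly
larger than the ranks of its proper extensions. -/
noncomputable def rootRank (R : X → X → Prop)
    (h : ∀ f : ℕ → X, ∃ m n, m < n ∧ ¬ R (f m) (f n)) : Ordinal.{u} :=
  ((wellFounded_extends h).apply (root R)).rank

end SeqTree

/-! ### Maximal order type and width of a well partial order -/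

section Invariants

variable (X : Type u) [PartialOrder X] [WellQuasiOrderedLE X]

/-- The maximal order type: the rank of the empty sequence in the tree of bad sequences. -/
noncomputable def maxOrderType : Ordinal.{u} :=
  SeqTree.rootRank (fun x y : X => ¬ x ≤ y) fun f => by
    obtain ⟨m, n, hmn, h⟩ := wellQuasiOrdered_le f
    exact ⟨m, n, hmn, not_not_intro h⟩

/-- The width: the rank of the empty sequence in the tree of antichains (finite sequences of
pairwise incomparable elements). -/
noncomputable def wpoWidth : Ordinal.{u} :=
  SeqTree.rootRank (fun x y : X => IncompRel (· ≤ ·) x y) fun f => by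
    obtain ⟨m, n, hmn, h⟩ := wellQuasiOrdered_le f
    exact ⟨m, n, hmn, fun hi => hi.1 h⟩

end Invariants

/-- Every subset of a well partial order is a well partial order for the induced order. -/
instance Subtype.instWellQuasiOrderedLEOfWpo {X : Type u} [PartialOrder X] [WellQuasiOrderedLE X]
    (S : Set X) : WellQuasiOrderedLE S :=
  ⟨fun f => wellQuasiOrdered_le fun n => (f n : X)⟩

/-! ### The multiset ordering -/

/-- The finite multisets of elements of `X`, to be ordered by the multiset ordering. -/
@[ext]
structure MultisetOrdering (X : Type u) : Type u where
  /-- The underlying finite multiset. -/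
  toMultiset : Multiset X

namespace MultisetOrdering

variable {X : Type u} [PartialOrder X]

open Classical in
/-- `m ≤ m'` iff `m = m'` or every `x ∈ m \ (m ∩ m')` is strictly below some
`y ∈ m' \ (m ∩ m')`. -/
instance instLE : LE (MultisetOrdering X) where
  le m m' := m = m' ∨
    ∀ x ∈ m.toMultiset - m.toMultiset ∩ m'.toMultiset,
      ∃ y ∈ m'.toMultiset - m.toMultiset ∩ m'.toMultiset, x < y

theorem exists_maximal_above (s : Multiset X) (p : X → Prop) (x : X) (hx : x ∈ s) (hp : p x) :
    ∃ y ∈ s, p y ∧ ∀ z ∈ s, p z → ¬ y < z := by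
  classical
  obtain ⟨y, hy⟩ := (s.toFinset.filter p).exists_maximal ⟨x, by simp [hx, hp]⟩
  have hy1 := hy.prop
  simp only [Finset.mem_filter, Multiset.mem_toFinset] at hy1
  exact ⟨y, hy1.1, hy1.2, fun z hz hpz hlt => hy.not_gt (by simp [hz, hpz]) hlt⟩

theorem le_iff {m m' : MultisetOrdering X} :
    m ≤ m' ↔ m = m' ∨ Multiset.IsDershowitzMannaLT m.toMultiset m'.toMultiset := by
  classical
  obtain ⟨a⟩ := m
  obtain ⟨b⟩ := m'
  constructor
  · rintro (h | h)
    · exact Or.inl h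
    · by_cases hab : a = b
      · exact Or.inl (by rw [hab])
      right
      have h' : ∀ x ∈ a - a ∩ b, ∃ y ∈ b - a ∩ b, x < y := by
        intro x hx
        exact h x (by convert hx)|>.imp fun y hy => ⟨by convert hy.1, hy.2⟩
      refine ⟨a ∩ b, a - a ∩ b, b - a ∩ b, ?_, ?_, ?_, h'⟩
      · intro hz
        have hz' : b - a ∩ b = 0 := hz
        have ha : a - a ∩ b = 0 := by
          refine Multiset.eq_zero_of_forall_notMem fun x hx => ?_
          obtain ⟨y, hy, -⟩ := h' x hx
          simp [hz'] at hy
        exact hab (le_antisymm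
          ((tsub_eq_zero_iff_le.1 ha).trans Multiset.inter_le_right)
          ((tsub_eq_zero_iff_le.1 hz').trans Multiset.inter_le_left))
      · exact (add_tsub_cancel_of_le Multiset.inter_le_left).symm
      · exact (add_tsub_cancel_of_le Multiset.inter_le_right).symm
  · rintro (h | ⟨c, y, z, -, hm, hn, hyz⟩)
    · exact Or.inl h
    · right
      simp only at hm hn
      subst hm hn
      intro x hx
      have hx' : x ∈ y := by
        rw [← Multiset.count_pos] at hx ⊢
        simp only [Multiset.count_sub, Multiset.count_inter, Multiset.count_add] at hx
        omega
      obtain ⟨w0, hw0, hxw0⟩ := hyz x hx'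
      obtain ⟨w, hw, hxw, hmax⟩ := exists_maximal_above (y + z) (x < ·) w0
        (Multiset.mem_add.2 (Or.inr hw0)) hxw0
      have hwy : w ∉ y := fun hwy => by
        obtain ⟨v, hv, hwv⟩ := hyz w hwy
        exact hmax v (Multiset.mem_add.2 (Or.inr hv)) (hxw.trans hwv) hwv
      have hwz : w ∈ z := (Multiset.mem_add.1 hw).resolve_left hwy
      refine ⟨w, ?_, hxw⟩
      rw [← Multiset.count_pos] at hwz ⊢
      have h0 := Multiset.count_eq_zero_of_notMem hwy
      simp only [Multiset.count_sub, Multiset.count_inter, Multiset.count_add]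
      omega

theorem not_isDershowitzMannaLT_self (a : Multiset X) :
    ¬ Multiset.IsDershowitzMannaLT a a := by
  rintro ⟨c, y, z, hz, h1, h2, hyz⟩
  have e : y = z := add_left_cancel (h1.symm.trans h2)
  subst e
  obtain ⟨x, hx⟩ := Multiset.exists_mem_of_ne_zero hz
  obtain ⟨w, hw, -, hmax⟩ := exists_maximal_above y (fun _ => True) x hx trivial
  obtain ⟨v, hv, hwv⟩ := hyz w hw
  exact hmax v hv trivial hwv

instance instPartialOrder : PartialOrder (MultisetOrdering X) where
  le_refl m := Or.inl rfl
  le_trans a b c hab hbc := by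
    rw [le_iff] at *
    rcases hab with rfl | hab
    · exact hbc
    · rcases hbc with rfl | hbc
      · exact Or.inr hab
      · exact Or.inr (hab.trans hbc)
  le_antisymm a b hab hba := by
    rw [le_iff] at *
    rcases hab with rfl | hab
    · rfl
    · rcases hba with h | hba
      · exact h.symm
      · exact (not_isDershowitzMannaLT_self _ (hab.trans hba)).elim

theorem le_of_sublistForall₂ {l l' : List X} (h : List.SublistForall₂ (· ≤ ·) l l') :
    (⟨(l : Multiset X)⟩ : MultisetOrdering X) ≤ ⟨(l' : Multiset X)⟩ := by
  have key : (l : Multiset X) = l' ∨ Multiset.IsDershowitzMannaLT (l : Multiset X) l' := by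
    induction h with
    | @nil l =>
      cases l with
      | nil => exact Or.inl rfl
      | cons a l =>
        exact Or.inr ⟨0, 0, ((a :: l : List X) : Multiset X), by simp, by simp, by simp, by simp⟩
    | @cons a b l l' hab _ ih =>
      rw [← Multiset.cons_coe, ← Multiset.cons_coe]
      rcases hab.eq_or_lt with rfl | hlt
      · rcases ih with e | ⟨c, y, z, hz, e1, e2, hyz⟩
        · exact Or.inl (by rw [e])
        · exact Or.inr ⟨a ::ₘ c, y, z, hz, by rw [e1, Multiset.cons_add],
            by rw [e2, Multiset.cons_add], hyz⟩
      · right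
        rcases ih with e | ⟨c, y, z, hz, e1, e2, hyz⟩
        · refine ⟨l, {a}, {b}, by simp, ?_, ?_, by simpa using hlt⟩
          · rw [add_comm, Multiset.singleton_add]
          · rw [e, add_comm, Multiset.singleton_add]
        · refine ⟨c, a ::ₘ y, b ::ₘ z, by simp, by rw [e1, Multiset.add_cons],
            by rw [e2, Multiset.add_cons], ?_⟩
          intro x hx
          rcases Multiset.mem_cons.1 hx with rfl | hx
          · exact ⟨b, Multiset.mem_cons_self _ _, hlt⟩
          · obtain ⟨w, hw, hxw⟩ := hyz x hx
            exact ⟨w, Multiset.mem_cons_of_mem hw, hxw⟩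
    | @cons_right b l l' _ ih =>
      rw [← Multiset.cons_coe]
      right
      rcases ih with e | ⟨c, y, z, hz, e1, e2, hyz⟩
      · refine ⟨l, 0, {b}, by simp, by simp, ?_, by simp⟩
        rw [e, add_comm, Multiset.singleton_add]
      · refine ⟨c, y, b ::ₘ z, by simp, e1, by rw [e2, Multiset.add_cons], fun x hx => ?_⟩
        obtain ⟨w, hw, hxw⟩ := hyz x hx
        exact ⟨w, Multiset.mem_cons_of_mem hw, hxw⟩
  rw [le_iff]
  exact key.imp (fun e => by rw [e]) id

/-- The multiset ordering on a well partial order is a well partial order. -/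
instance instWellQuasiOrderedLE [WellQuasiOrderedLE X] :
    WellQuasiOrderedLE (MultisetOrdering X) where
  wqo f := by
    have hp : (Set.univ : Set X).PartiallyWellOrderedOn (· ≤ ·) :=
      Set.isPWO_of_wellQuasiOrderedLE _
    obtain ⟨m, n, hmn, h⟩ :=
      (hp.partiallyWellOrderedOn_sublistForall₂ (· ≤ ·)).exists_lt
        (f := fun n => (f n).toMultiset.toList) (fun n x _ => Set.mem_univ x)
    refine ⟨m, n, hmn, ?_⟩
    have := le_of_sublistForall₂ h
    simpa only [Multiset.coe_toList] using this

end MultisetOrdering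

/-! ### The maximal safe order type -/

section Safe

variable {X : Type u} [PartialOrder X] [WellQuasiOrderedLE X]

/-- A subset `S` of `X` is safe if there is a maximal linearisation of `S`, i.e. a monotone
bijection `ℓ` from `S` onto the set of ordinals below the maximal order type of `S`, satisfying the
safety condition: for every finite (possibly empty) family `x₁, …, xₙ` in `S` and every `x ∈ S`
with `ℓ x < ℓ xᵢ` for all `i`, some `z ∈ X` is incomparable to `x` and satisfies `¬ xᵢ ≤ z` for
all `i`. -/
def IsSafe (S : Set X) : Prop :=
  ∃ ℓ : S ≃ Set.Iio (maxOrderType S), Monotone ℓ ∧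
    ∀ (F : Finset S) (x : S), (∀ y ∈ F, ℓ x < ℓ y) →
      ∃ z : X, (∀ y ∈ F, ¬ (y : X) ≤ z) ∧ IncompRel (· ≤ ·) z (x : X)

variable (X) in
/-- The maximal safe order type of `X`: the supremum of the maximal order types of its safe
subsets. -/
noncomputable def maxSafeOrderType : Ordinal.{u} :=
  ⨆ S : {S : Set X // IsSafe S}, maxOrderType (S : Set X)

end Safe

/-! Both sides are computed through a third invariant, the friendly rank `frank D Y`: the rank of
the tree of bad sequences in `Y` in which each term `x`, when it is chosen, is incomparable to some
element of `D` that is not above any earlier term (a friend of `x`).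

Multisets over `D` have width `ω ^ frank D D`, by induction on `frank D D`. If `m'` is incomparable
to `m`, there is a highest place `x` in `m` where `m'` has fewer copies while the two agree above
`x`, and `x` has a friend. Hence the residual of `m` is a finite union of sets no wider than the
multisets over some `avoid D x`, and natural sums of ordinals below `ω ^ e` stay below `ω ^ e`
(`multisetWidth_le`). Conversely, if `x` has a friend `z`, the widths of multisets over `avoid D x`
can be stacked `n` times: the number of copies of `x` decreases from block to block, and copies of
`z` keep later blocks from lying below earlier ones (`multisetWidth_avoid_mul_le`).

The friendly rank of `X` is also its maximal safe order type. A safe linearisation read downwards is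
a friendly bad sequence. For the converse, `exists_safeLin` finds in any `Y` a safe linearisation at
least as long as `frank D Y`. It is a maximal linearisation if `Y` has maximal order type at most
`frank D D` without losing friendly rank. Such a `Y` (`IsFriendlyCore`) is assembled from the
indecomposable summands of `D`, where order type and friendly rank differ by at most one unless the
summand is a point (`otype_le_frank_add_one`). -/

open Set

/-! ### The natural sum of ordinals -/

/-- The natural (Hessenberg) sum, defined as the least operation on ordinals that is
strictly monotone in both arguments. -/
noncomputable def natSum (a b : Ordinal.{u}) : Ordinal.{u} :=
  max (⨆ x : Set.Iio a, Order.succ (natSum x.1 b)) (⨆ x : Set.Iio b, Order.succ (natSum a x.1))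
termination_by (a, b)
decreasing_by
  · exact Prod.Lex.left _ _ x.2
  · exact Prod.Lex.right _ x.2

theorem natSum_le_iff {a b c : Ordinal.{u}} :
    natSum a b ≤ c ↔ (∀ a' < a, natSum a' b < c) ∧ ∀ b' < b, natSum a b' < c := by
  rw [natSum, max_le_iff, Ordinal.iSup_le_iff, Ordinal.iSup_le_iff]
  simp only [Order.succ_le_iff, Subtype.forall, Set.mem_Iio]

theorem natSum_lt_left {a a' : Ordinal.{u}} (h : a' < a) (b : Ordinal.{u}) :
    natSum a' b < natSum a b :=
  (natSum_le_iff.1 le_rfl).1 a' h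

theorem natSum_lt_right (a : Ordinal.{u}) {b b' : Ordinal.{u}} (h : b' < b) :
    natSum a b' < natSum a b :=
  (natSum_le_iff.1 le_rfl).2 b' h

theorem natSum_mono {a a' b b' : Ordinal.{u}} (ha : a ≤ a') (hb : b ≤ b') :
    natSum a b ≤ natSum a' b' := by
  have h1 : natSum a b ≤ natSum a' b := by
    rcases ha.eq_or_lt with rfl | h
    · exact le_rfl
    · exact (natSum_lt_left h b).le
  rcases hb.eq_or_lt with rfl | h
  · exact h1
  · exact h1.trans (natSum_lt_right a' h).le

theorem natSum_zero (a : Ordinal.{u}) : natSum a 0 = a := by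
  induction a using WellFoundedLT.induction with
  | ind a ih =>
    apply le_antisymm
    · rw [natSum_le_iff]
      refine ⟨fun a' h => by rwa [ih a' h], fun b h => absurd h (not_lt_bot)⟩
    · refine le_of_forall_lt fun c hc => ?_
      rw [← ih c hc]
      exact natSum_lt_left hc 0

theorem natSum_add_le (a b c : Ordinal.{u}) : natSum a (b + c) ≤ natSum (natSum a b) c := by
  induction a using WellFoundedLT.induction generalizing c with
  | ind a iha =>
    induction c using WellFoundedLT.induction with
    | ind c ihc =>
      rw [natSum_le_iff]
      refine ⟨fun a' h => (iha a' h c).trans_lt (natSum_lt_left (natSum_lt_left h b) c),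
        fun b' h => ?_⟩
      rcases lt_or_ge b' b with hb | hb
      · calc natSum a b' < natSum a b := natSum_lt_right a hb
          _ = natSum (natSum a b) 0 := (natSum_zero _).symm
          _ ≤ _ := natSum_mono le_rfl (zero_le)
      · obtain ⟨c', rfl⟩ := le_iff_exists_add.1 hb
        have hc : c' < c := lt_of_add_lt_add_left h
        exact (ihc c' hc).trans_lt (natSum_lt_right _ hc)

/-- Here `w` stands for a power of `ω`, and `h` is the absorption property already known for it.
Smaller left arguments are handled by lexicographic induction on quotient and remainder modulo `w`,
smaller right arguments by `h`. -/
theorem natSum_mul_add_le {w : Ordinal.{u}} (hw : 0 < w)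
    (h : ∀ g a b, a < w * g → b < w → natSum a b < w * g) (q s : Ordinal.{u}) (hs : s < w) :
    natSum (w * q + s) w ≤ w * (q + 1) + s := by
  induction q using WellFoundedLT.induction generalizing s with
  | ind q ihq =>
    induction s using WellFoundedLT.induction with
    | ind s ihs =>
      rw [natSum_le_iff]
      constructor
      · intro a' ha'
        have hdm := Ordinal.div_add_mod a' w
        have hm := Ordinal.mod_lt a' hw.ne'
        rw [← hdm] at ha' ⊢
        have hq : a' / w ≤ q := by
          by_contra! hlt
          have h1 : w * (q + 1) ≤ w * (a' / w) := by
            gcongr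
            exact Order.add_one_le_of_lt hlt
          rw [mul_add, mul_one] at h1
          have h2 : w * q + s < w * q + w := by gcongr
          exact (h2.trans_le (h1.trans le_self_add)).not_gt ha'
        rcases hq.eq_or_lt with hq | hq
        · rw [hq] at ha' ⊢
          have : a' % w < s := lt_of_add_lt_add_left ha'
          exact (ihs _ this hm).trans_lt (by gcongr)
        · refine (ihq _ hq _ hm).trans_lt ?_
          calc w * (a' / w + 1) + a' % w < w * (a' / w + 1) + w := by gcongr
            _ = w * (a' / w + 1 + 1) := by rw [mul_add w (_ + 1) 1, mul_one]
            _ ≤ w * (q + 1) := by gcongr; exact Order.add_one_le_of_lt hq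
            _ ≤ _ := le_self_add
      · intro b hb
        refine (h (q + 1) _ b ?_ hb).trans_le le_self_add
        rw [mul_add, mul_one]
        gcongr

theorem natSum_lt_mul_nat {w : Ordinal.{u}} (hw : 0 < w)
    (h : ∀ g a b, a < w * g → b < w → natSum a b < w * g) (n : ℕ) (q a : Ordinal.{u})
    (ha : a < w * q) : natSum a (w * n) < w * (q + n) := by
  induction n with
  | zero => simpa [natSum_zero] using ha
  | succ n ih =>
    have h1 : natSum a (w * ((n + 1 : ℕ) : Ordinal.{u})) ≤ natSum (natSum a (w * n)) w := by
      rw [Nat.cast_add, Nat.cast_one, mul_add, mul_one]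
      exact natSum_add_le _ _ _
    refine h1.trans_lt ?_
    set c := natSum a (w * n)
    have hm := Ordinal.mod_lt c hw.ne'
    have h2 := natSum_mul_add_le hw h (c / w) (c % w) hm
    rw [Ordinal.div_add_mod] at h2
    refine h2.trans_lt ?_
    have hq : c / w < q + n := (Ordinal.lt_mul_iff_div_lt hw.ne').1 ih
    calc w * (c / w + 1) + c % w < w * (c / w + 1) + w := by gcongr
      _ = w * (c / w + 1 + 1) := by rw [mul_add w (_ + 1) 1, mul_one]
      _ ≤ w * (q + (n + 1 : ℕ)) := by
        rw [Nat.cast_add, Nat.cast_one, ← add_assoc]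
        have := Order.add_one_le_of_lt hq
        gcongr

/-- At a successor exponent, `b` is below finitely many copies of `ω ^ e`, each raising the quotient
of `a` by at most one, and `ω * g` is a limit. At a limit, `b < ω ^ d` for some `d < e`, and the
rest of the power is absorbed into `g`; this is why `g` is arbitrary. -/
theorem natSum_lt_opow_mul (e g a b : Ordinal.{u}) (ha : a < ω ^ e * g) (hb : b < ω ^ e) :
    natSum a b < ω ^ e * g := by
  induction e using Ordinal.limitRecOn generalizing g a b with
  | zero =>
    rw [Ordinal.opow_zero, Order.lt_one_iff] at hb
    rwa [hb, natSum_zero]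
  | add_one e ih =>
    have hw : 0 < (ω : Ordinal.{u}) ^ e := Ordinal.opow_pos _ Ordinal.omega0_pos
    rw [Ordinal.opow_add, Ordinal.opow_one] at ha hb ⊢
    rw [mul_assoc] at ha ⊢
    obtain ⟨n, hn⟩ : ∃ n : ℕ, b < ω ^ e * n := by
      obtain ⟨c, hc, hbc⟩ := (Ordinal.lt_mul_iff_of_isSuccLimit Ordinal.isSuccLimit_omega0).1 hb
      obtain ⟨n, rfl⟩ := Ordinal.lt_omega0.1 hc
      exact ⟨n, hbc⟩
    have hg : g ≠ 0 := by
      rintro rfl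
      simp at ha
    have hlim : Order.IsSuccLimit (ω * g) :=
      Ordinal.isSuccLimit_mul_left Ordinal.isSuccLimit_omega0 (pos_iff_ne_zero.2 hg)
    obtain ⟨q, hq, haq⟩ := (Ordinal.lt_mul_iff_of_isSuccLimit hlim).1 ha
    calc natSum a b ≤ natSum a (ω ^ e * n) := natSum_mono le_rfl hn.le
      _ < ω ^ e * (q + n) := natSum_lt_mul_nat hw (fun g a b => ih g a b) n q a haq
      _ ≤ _ := by
        gcongr
        have : ∀ m : ℕ, q + m < ω * g := by
          intro m
          induction m with
          | zero => simpa using hq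
          | succ m ihm =>
            rw [Nat.cast_add, Nat.cast_one, ← add_assoc]
            exact hlim.succ_lt ihm
        exact (this n).le
  | limit e he ih =>
    obtain ⟨d, hd, hbd⟩ := (Ordinal.lt_opow_of_isSuccLimit Ordinal.omega0_ne_zero he).1 hb
    have hed : e = d + (e - d) := (Ordinal.add_sub_cancel_of_le hd.le).symm
    rw [hed, Ordinal.opow_add, mul_assoc] at ha ⊢
    exact ih d hd _ _ _ ha hbd

theorem natSum_lt_opow {e a b : Ordinal.{u}} (ha : a < ω ^ e) (hb : b < ω ^ e) :
    natSum a b < ω ^ e := by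
  have := natSum_lt_opow_mul e 1 a b
  rw [mul_one] at this
  exact this ha hb

/-! ### Ranks of sets for a relation without infinite sequences -/

/-- There is no infinite sequence `f` with `R (f m) (f n)` for all `m < n`. -/
class NoInfiniteSeq {α : Type u} (R : α → α → Prop) : Prop where
  exists_not_rel : ∀ f : ℕ → α, ∃ m n, m < n ∧ ¬ R (f m) (f n)

/-- `ResidualOf R T S`: the set `T` consists of the elements of `S` that may follow a certain
element of `S`. -/
def ResidualOf {α : Type u} (R : α → α → Prop) (T S : Set α) : Prop :=
  ∃ x ∈ S, T = S ∩ {y | R x y}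

instance ResidualOf.isWellFounded {α : Type u} (R : α → α → Prop) [NoInfiniteSeq R] :
    IsWellFounded (Set α) (ResidualOf R) := by
  refine ⟨?_⟩
  rw [wellFounded_iff_isEmpty_descending_chain]
  refine ⟨fun ⟨S, hS⟩ => ?_⟩
  choose x hx hS using hS
  have hsub : ∀ m n, m ≤ n → S n ⊆ S m := by
    intro m n hmn
    induction n, hmn using Nat.le_induction with
    | base => exact subset_rfl
    | succ n _ ih => exact (by rw [hS n]; exact inter_subset_left.trans ih)
  obtain ⟨m, n, hmn, h⟩ := NoInfiniteSeq.exists_not_rel (R := R) x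
  have := hsub (m + 1) n hmn (hx n)
  rw [hS m] at this
  exact h this.2

/-- The rank of the tree of finite sequences in `S` satisfying `R xᵢ xⱼ` for all `i < j`. -/
noncomputable def seqRank {α : Type u} (R : α → α → Prop) [NoInfiniteSeq R] (S : Set α) :
    Ordinal.{u} :=
  IsWellFounded.rank (ResidualOf R) S

section SeqRank

variable {α β : Type u} {R : α → α → Prop} [NoInfiniteSeq R] {R' : β → β → Prop}
  [NoInfiniteSeq R']

theorem seqRank_residual_lt {S : Set α} {x : α} (hx : x ∈ S) :
    seqRank R (S ∩ {y | R x y}) < seqRank R S :=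
  IsWellFounded.rank_lt_of_rel ⟨x, hx, rfl⟩

theorem seqRank_le_iff {S : Set α} {a : Ordinal.{u}} :
    seqRank R S ≤ a ↔ ∀ x ∈ S, seqRank R (S ∩ {y | R x y}) < a := by
  rw [seqRank, IsWellFounded.rank_eq, Ordinal.iSup_le_iff]
  simp only [Order.succ_le_iff, Subtype.forall]
  constructor
  · exact fun h x hx => h _ ⟨x, hx, rfl⟩
  · rintro h _ ⟨x, hx, rfl⟩
    exact h x hx

theorem lt_seqRank_iff {S : Set α} {a : Ordinal.{u}} :
    a < seqRank R S ↔ ∃ x ∈ S, a ≤ seqRank R (S ∩ {y | R x y}) := by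
  rw [← not_le, seqRank_le_iff]
  push Not
  rfl

variable (R) in
theorem residual_induction {P : Set α → Prop}
    (h : ∀ S, (∀ x ∈ S, P (S ∩ {y | R x y})) → P S) (S : Set α) : P S := by
  induction S using (ResidualOf.isWellFounded R).wf.induction with
  | _ S ih => exact h S fun x hx => ih _ ⟨x, hx, rfl⟩

/-- Simulation principle for ranks. -/
theorem seqRank_le_of_simulation (V : α → β → Prop) {S : Set α} {T : Set β}
    (hV : ∀ x ∈ S, ∃ x' ∈ T, V x x')
    (hR : ∀ x ∈ S, ∀ y ∈ S, ∀ x' ∈ T, ∀ y' ∈ T, V x x' → V y y' → R x y → R' x' y') :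
    seqRank R S ≤ seqRank R' T := by
  induction S using residual_induction R generalizing T with
  | h S ih =>
    rw [seqRank_le_iff]
    intro x hx
    obtain ⟨x', hx', hV'⟩ := hV x hx
    refine (ih x hx (T := T ∩ {y | R' x' y}) ?_ ?_).trans_lt (seqRank_residual_lt hx')
    · rintro y ⟨hy, hxy⟩
      obtain ⟨y', hy', hVy⟩ := hV y hy
      exact ⟨y', ⟨hy', hR x hx y hy x' hx' y' hy' hV' hVy hxy⟩, hVy⟩
    · exact fun a ha b hb a' ha' b' hb' => hR a ha.1 b hb.1 a' ha'.1 b' hb'.1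

theorem seqRank_le_of_mapsTo (φ : α → β) {S : Set α} {T : Set β} (hφ : MapsTo φ S T)
    (hR : ∀ x ∈ S, ∀ y ∈ S, R x y → R' (φ x) (φ y)) : seqRank R S ≤ seqRank R' T := by
  refine seqRank_le_of_simulation (fun x x' => φ x = x') (fun x hx => ⟨_, hφ hx, rfl⟩) ?_
  rintro x hx y hy _ - _ - rfl rfl h
  exact hR x hx y hy h

theorem seqRank_mono {S T : Set α} (h : S ⊆ T) : seqRank R S ≤ seqRank R T :=
  seqRank_le_of_mapsTo id h fun _ _ _ _ h => h

theorem seqRank_lt_of_subset_residual {S T : Set α} {x : α} (hx : x ∈ S)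
    (h : T ⊆ S ∩ {y | R x y}) : seqRank R T < seqRank R S :=
  (seqRank_mono h).trans_lt (seqRank_residual_lt hx)

theorem seqRank_empty : seqRank R (∅ : Set α) = 0 := by
  rw [← le_zero_iff, seqRank_le_iff]
  exact fun x hx => hx.elim

theorem seqRank_pos {S : Set α} (h : S.Nonempty) : 0 < seqRank R S := by
  obtain ⟨x, hx⟩ := h
  exact (zero_le).trans_lt (seqRank_residual_lt hx)

/-- A step in the union strictly lowers the rank of the part it is taken from and does not raise the
other. -/
theorem seqRank_union_le (S T : Set α) :
    seqRank R (S ∪ T) ≤ natSum (seqRank R S) (seqRank R T) := by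
  suffices ∀ U S T : Set α, U = S ∪ T →
      seqRank R U ≤ natSum (seqRank R S) (seqRank R T) from this _ S T rfl
  intro U
  induction U using residual_induction R with
  | h U ih =>
    rintro S T rfl
    rw [seqRank_le_iff]
    intro x hx
    refine (ih x hx _ _ (union_inter_distrib_right _ _ _)).trans_lt ?_
    rcases hx with hx | hx
    · exact (natSum_lt_left (seqRank_residual_lt hx) _).trans_le
        (natSum_mono le_rfl (seqRank_mono inter_subset_left))
    · exact (natSum_lt_right _ (seqRank_residual_lt hx)).trans_le
        (natSum_mono (seqRank_mono inter_subset_left) le_rfl)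

/-- If any finite number of elements of `A` can be followed by sequences of rank `r` in `T`,
then `A ∪ T` has rank at least `r + seqRank R A`. -/
theorem add_seqRank_le_of_forall_list {A T : Set α} {r : Ordinal.{u}}
    (h : ∀ l : List α, (∀ x ∈ l, x ∈ A) → r ≤ seqRank R (T ∩ {y | ∀ x ∈ l, R x y})) :
    r + seqRank R A ≤ seqRank R (A ∪ T) := by
  induction A using residual_induction R generalizing T with
  | h A ih =>
    refine le_of_forall_lt fun c hc => ?_
    rcases lt_or_ge c r with hcr | hcr
    · refine (hcr.trans_le (h [] (by simp))).trans_le (seqRank_mono ?_)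
      exact inter_subset_left.trans subset_union_right
    · obtain ⟨c, rfl⟩ := le_iff_exists_add.1 hcr
      obtain ⟨x, hx, hcx⟩ := lt_seqRank_iff.1 (lt_of_add_lt_add_left hc)
      refine lt_of_le_of_lt ?_ (seqRank_residual_lt (R := R) (mem_union_left T hx))
      rw [union_inter_distrib_right]
      refine (add_le_add_right hcx r).trans (ih x hx fun l hl => ?_)
      refine (h (x :: l) ?_).trans (seqRank_mono ?_)
      · simp only [List.mem_cons, forall_eq_or_imp]
        exact ⟨hx, fun y hy => (hl y hy).1⟩
      · rintro y ⟨hy, hy'⟩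
        simp only [List.mem_cons, forall_eq_or_imp, mem_ofPred_eq] at hy'
        exact ⟨⟨hy, hy'.1⟩, hy'.2⟩

/-- `B` is played first and leaves `A` intact, whence the order of the summands. -/
theorem seqRank_add_le_union {A B : Set α} (h : ∀ a ∈ A, ∀ b ∈ B, R b a) :
    seqRank R A + seqRank R B ≤ seqRank R (A ∪ B) := by
  rw [union_comm]
  refine add_seqRank_le_of_forall_list fun l hl => seqRank_mono ?_
  exact fun a ha => ⟨ha, fun b hb => h a ha b (hl b hb)⟩

/-- After the first move in `A`, no element of `B` can follow. -/
theorem seqRank_union_le_add {A B : Set α} (h : ∀ a ∈ A, ∀ b ∈ B, ¬ R a b) :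
    seqRank R (A ∪ B) ≤ seqRank R A + seqRank R B := by
  induction B using residual_induction R with
  | h B ih =>
    rw [seqRank_le_iff]
    rintro x (hx | hx)
    · refine (seqRank_lt_of_subset_residual hx (T := (A ∪ B) ∩ {y | R x y}) ?_).trans_le le_self_add
      rintro y ⟨hy | hy, hxy⟩
      · exact ⟨hy, hxy⟩
      · exact absurd hxy (h x hx y hy)
    · refine lt_of_le_of_lt ?_ (add_lt_add_right (seqRank_residual_lt (R := R) hx) _)
      refine le_trans (seqRank_mono ?_) (ih x hx fun a ha b hb => h a ha b hb.1)
      rintro y ⟨hy | hy, hxy⟩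
      · exact Or.inl hy
      · exact Or.inr ⟨hy, hxy⟩

theorem seqRank_insert_le (S : Set α) (x : α) (h : ¬ R x x) :
    seqRank R (insert x S) ≤ seqRank R S + 1 := by
  induction S using residual_induction R with
  | h S ih =>
    rw [seqRank_le_iff]
    have key : ∀ y ∈ S, seqRank R (insert x S ∩ {z | R y z}) < seqRank R S + 1 := by
      intro y hy
      refine ((seqRank_mono ?_).trans (ih y hy)).trans_lt
        (Order.lt_add_one_iff.2 (Order.add_one_le_of_lt (seqRank_residual_lt hy)))
      rintro z ⟨rfl | hz, hyz⟩
      · exact mem_insert _ _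
      · exact mem_insert_of_mem _ ⟨hz, hyz⟩
    rintro y (rfl | hy)
    · refine (seqRank_mono ?_).trans_lt (Order.lt_add_one_iff.2 (le_refl (seqRank R S)))
      rintro z ⟨rfl | hz, hyz⟩
      · exact absurd hyz h
      · exact hz
    · exact key y hy

theorem seqRank_preimage_val (S : Set α) :
    haveI : NoInfiniteSeq (fun x y : S => R x y) := ⟨fun f =>
      NoInfiniteSeq.exists_not_rel (R := R) fun n => (f n : α)⟩
    seqRank (fun x y : S => R x y) univ = seqRank R S := by
  have : NoInfiniteSeq (fun x y : S => R x y) := ⟨fun f =>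
    NoInfiniteSeq.exists_not_rel (R := R) fun n => (f n : α)⟩
  apply le_antisymm
  · exact seqRank_le_of_mapsTo Subtype.val (fun x _ => x.2) fun _ _ _ _ h => h
  · refine seqRank_le_of_simulation (fun x x' => x = x'.1) (fun x hx => ⟨⟨x, hx⟩, mem_univ _, rfl⟩) ?_
    rintro _ - _ - x - y - rfl rfl h
    exact h

/-- The subtree above a sequence depends only on the set of elements that may still follow it. -/
theorem SeqTree.rank_eq_seqRank (h : ∀ f : ℕ → α, ∃ m n, m < n ∧ ¬ R (f m) (f n))
    (t : SeqTree R) :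
    ((SeqTree.wellFounded_extends h).apply t).rank = seqRank R {y | ∀ x ∈ t.toList, R x y} := by
  induction t using (SeqTree.wellFounded_extends h).induction with
  | _ t ih =>
    apply le_antisymm
    · rw [Acc.rank_eq, Ordinal.iSup_le_iff]
      rintro ⟨s, hs⟩
      rw [Order.succ_le_iff]
      refine (ih s hs).trans_lt ?_
      obtain ⟨⟨l, hl⟩, hne⟩ := hs
      cases l with
      | nil => exact absurd (SeqTree.ext (by simpa using hl)) hne
      | cons x l =>
        have hp := s.pairwise
        rw [← hl, List.pairwise_append] at hp
        refine seqRank_lt_of_subset_residual (x := x) (fun y hy => hp.2.2 y hy x (by simp)) ?_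
        intro y hy
        simp only [mem_ofPred_eq, ← hl, List.mem_append, List.mem_cons] at hy
        exact ⟨fun z hz => hy z (Or.inl hz), hy x (Or.inr (Or.inl rfl))⟩
    · rw [seqRank_le_iff]
      intro x hx
      have hs : (t.toList ++ [x]).Pairwise R := by
        rw [List.pairwise_append]
        exact ⟨t.pairwise, by simp, fun y hy z hz => by
          rw [List.mem_singleton.1 hz]; exact hx y hy⟩
      have hext : Extends (⟨_, hs⟩ : SeqTree R) t :=
        ⟨List.prefix_append _ _, fun e => by
          have := congrArg (fun s => s.toList.length) e
          simp at this⟩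
      refine lt_of_eq_of_lt ?_ (Acc.rank_lt_of_rel ((SeqTree.wellFounded_extends h).apply t) hext)
      rw [ih _ hext]
      congr 1
      ext y
      simp only [mem_inter_iff, mem_ofPred_eq, List.mem_append, List.mem_singleton]
      constructor
      · rintro ⟨h1, h2⟩ z (hz | rfl)
        exacts [h1 z hz, h2]
      · exact fun h1 => ⟨fun z hz => h1 z (Or.inl hz), h1 x (Or.inr rfl)⟩

theorem SeqTree.rootRank_eq_seqRank (h : ∀ f : ℕ → α, ∃ m n, m < n ∧ ¬ R (f m) (f n)) :
    SeqTree.rootRank R h = seqRank R univ := by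
  rw [SeqTree.rootRank, SeqTree.rank_eq_seqRank]
  · simp [SeqTree.root]
  · exact h

end SeqRank

/-! ### Bad sequences, antichains and friendly sequences -/

section Friendly

variable {X : Type u} [PartialOrder X]

/-- The relation of bad sequences. -/
def Bad (x y : X) : Prop := ¬ x ≤ y

/-- The relation of antichains. -/
def Incomp (x y : X) : Prop := IncompRel (· ≤ ·) x y

/-- Bad sequences of elements `x`, each paired with a witness `z` (incomparable to `x`) that
belongs to the residual of the sequence. -/
def FriendlyBad (p q : X × X) : Prop := ¬ p.1 ≤ q.1 ∧ ¬ p.1 ≤ q.2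

/-- The sequences that descend for a map to the ordinals. -/
def Descends {X : Type u} (ρ : X → Ordinal.{u}) (x y : X) : Prop := ρ y < ρ x

instance Descends.noInfiniteSeq {X : Type u} (ρ : X → Ordinal.{u}) :
    NoInfiniteSeq (Descends ρ) := ⟨fun f => by
  by_contra! h
  have := (wellFounded_iff_isEmpty_descending_chain.1 (wellFounded_lt (α := Ordinal.{u})))
  exact this.false ⟨fun n => ρ (f n), fun n => h n (n + 1) (Nat.lt_succ_self n)⟩⟩

/-- The part of `D` not above `y`. -/
abbrev avoid (D : Set X) (y : X) : Set X := D ∩ {z | ¬ y ≤ z}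

/-- The elements of `Y` paired with incomparable elements of `D`. -/
def friendPairs (D Y : Set X) : Set (X × X) :=
  {p | p.1 ∈ Y ∧ p.2 ∈ D ∧ Incomp p.2 p.1}

theorem avoid_mono {D D' : Set X} (h : D ⊆ D') (y : X) : avoid D y ⊆ avoid D' y :=
  inter_subset_inter_left _ h

theorem friendPairs_mono {D D' Y Y' : Set X} (hD : D ⊆ D') (hY : Y ⊆ Y') :
    friendPairs D Y ⊆ friendPairs D' Y' :=
  fun _ hp => ⟨hY hp.1, hD hp.2.1, hp.2.2⟩

theorem friendPairs_residual (D Y : Set X) (p : X × X) :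
    friendPairs D Y ∩ {q | FriendlyBad p q} = friendPairs (avoid D p.1) (avoid Y p.1) := by
  ext q
  constructor
  · rintro ⟨⟨h1, h2, h3⟩, h4, h5⟩
    exact ⟨⟨h1, h4⟩, ⟨h2, h5⟩, h3⟩
  · rintro ⟨⟨h1, h4⟩, ⟨h2, h5⟩, h3⟩
    exact ⟨⟨h1, h2, h3⟩, h4, h5⟩

/-- A safe linearisation of `S`, with witnesses in `D`. -/
structure SafeLin (D S : Set X) (ρ : X → Ordinal.{u}) : Prop where
  injOn : InjOn ρ S
  mono : ∀ x ∈ S, ∀ y ∈ S, x ≤ y → ρ x ≤ ρ y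
  safe : ∀ l : List X, (∀ y ∈ l, y ∈ S) → ∀ x ∈ S, (∀ y ∈ l, ρ x < ρ y) →
    ∃ z ∈ D, (∀ y ∈ l, ¬ y ≤ z) ∧ Incomp z x

theorem SafeLin.subset {D D' S S' : Set X} {ρ : X → Ordinal.{u}} (h : SafeLin D S ρ)
    (hD : D ⊆ D') (hS : S' ⊆ S) : SafeLin D' S' ρ where
  injOn := h.injOn.mono hS
  mono x hx y hy := h.mono x (hS hx) y (hS hy)
  safe l hl x hx hxl := by
    obtain ⟨z, hz, h1⟩ := h.safe l (fun y hy => hS (hl y hy)) x (hS hx) hxl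
    exact ⟨z, hD hz, h1⟩

variable [WellQuasiOrderedLE X]

instance Bad.noInfiniteSeq : NoInfiniteSeq (Bad (X := X)) := ⟨fun f => by
  obtain ⟨m, n, hmn, h⟩ := wellQuasiOrdered_le f
  exact ⟨m, n, hmn, not_not_intro h⟩⟩

instance Incomp.noInfiniteSeq : NoInfiniteSeq (Incomp (X := X)) := ⟨fun f => by
  obtain ⟨m, n, hmn, h⟩ := wellQuasiOrdered_le f
  exact ⟨m, n, hmn, fun hi => hi.1 h⟩⟩

instance FriendlyBad.noInfiniteSeq : NoInfiniteSeq (FriendlyBad (X := X)) := ⟨fun f => by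
  obtain ⟨m, n, hmn, h⟩ := wellQuasiOrdered_le fun n => (f n).1
  exact ⟨m, n, hmn, fun hi => hi.1 h⟩⟩

/-- The maximal order type of a subset. -/
noncomputable def otype (Y : Set X) : Ordinal.{u} := seqRank Bad Y

/-- The friendly rank of `Y` relative to `D`: the rank of the tree of bad sequences in `Y` all of
whose elements `x` are incomparable to some element of `D` in the residual at `x`. -/
noncomputable def frank (D Y : Set X) : Ordinal.{u} := seqRank FriendlyBad (friendPairs D Y)

theorem maxOrderType_coe (S : Set X) : maxOrderType S = otype S := by
  rw [otype, ← seqRank_preimage_val]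
  exact SeqTree.rootRank_eq_seqRank (R := Bad (X := S)) Bad.noInfiniteSeq.exists_not_rel

theorem wpoWidth_eq_seqRank : wpoWidth X = seqRank (Incomp (X := X)) univ :=
  SeqTree.rootRank_eq_seqRank (R := Incomp (X := X)) _

theorem otype_mono {Y Y' : Set X} (h : Y ⊆ Y') : otype Y ≤ otype Y' := seqRank_mono h

theorem otype_avoid_lt {Y : Set X} {x : X} (hx : x ∈ Y) : otype (avoid Y x) < otype Y :=
  seqRank_residual_lt hx

theorem otype_le_iff {Y : Set X} {a : Ordinal.{u}} :
    otype Y ≤ a ↔ ∀ x ∈ Y, otype (avoid Y x) < a := seqRank_le_iff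

theorem lt_otype_iff {Y : Set X} {a : Ordinal.{u}} :
    a < otype Y ↔ ∃ x ∈ Y, a ≤ otype (avoid Y x) := lt_seqRank_iff

theorem frank_mono {D D' Y Y' : Set X} (hD : D ⊆ D') (hY : Y ⊆ Y') : frank D Y ≤ frank D' Y' :=
  seqRank_mono (friendPairs_mono hD hY)

theorem lt_frank_iff {D Y : Set X} {a : Ordinal.{u}} :
    a < frank D Y ↔ ∃ x ∈ Y, (∃ z ∈ D, Incomp z x) ∧ a ≤ frank (avoid D x) (avoid Y x) := by
  rw [frank, lt_seqRank_iff]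
  simp only [friendPairs_residual]
  constructor
  · rintro ⟨p, ⟨h1, h2, h3⟩, h⟩
    exact ⟨p.1, h1, ⟨p.2, h2, h3⟩, h⟩
  · rintro ⟨x, hx, ⟨z, hz, hzx⟩, h⟩
    exact ⟨(x, z), ⟨hx, hz, hzx⟩, h⟩

theorem frank_avoid_lt {D Y : Set X} {x z : X} (hx : x ∈ Y) (hz : z ∈ D) (hzx : Incomp z x) :
    frank (avoid D x) (avoid Y x) < frank D Y :=
  lt_frank_iff.2 ⟨x, hx, ⟨z, hz, hzx⟩, le_rfl⟩

theorem otype_empty : otype (∅ : Set X) = 0 := seqRank_empty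

theorem frank_union_le (D Y Y' : Set X) :
    frank D (Y ∪ Y') ≤ natSum (frank D Y) (frank D Y') := by
  refine (seqRank_mono ?_).trans (seqRank_union_le _ _)
  rintro p ⟨h1 | h1, h2⟩
  · exact Or.inl ⟨h1, h2⟩
  · exact Or.inr ⟨h1, h2⟩

theorem frank_add_le_union {A B Y Z : Set X} (h : ∀ a ∈ A ∪ Y, ∀ b ∈ Z, ¬ b ≤ a) :
    frank A Y + frank B Z ≤ frank (A ∪ B) (Y ∪ Z) := by
  refine (seqRank_add_le_union ?_).trans (seqRank_mono ?_)
  · rintro p ⟨h1, h2, -⟩ q ⟨h3, -, -⟩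
    exact ⟨h p.1 (Or.inr h1) q.1 h3, h p.2 (Or.inl h2) q.1 h3⟩
  · exact union_subset (friendPairs_mono subset_union_left subset_union_left)
      (friendPairs_mono subset_union_right subset_union_right)

/-- Friends lie in the same summand, because elements of `A` and of `B` are comparable. -/
theorem frank_union_le_add {A B Y Z : Set X} (hY : Y ⊆ A) (hZ : Z ⊆ B)
    (h : ∀ a ∈ A, ∀ b ∈ B, a < b) : frank (A ∪ B) (Y ∪ Z) ≤ frank A Y + frank B Z := by
  refine (seqRank_mono ?_).trans (seqRank_union_le_add ?_)
  · rintro p ⟨h1 | h1, h2 | h2, h3⟩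
    · exact Or.inl ⟨h1, h2, h3⟩
    · exact absurd (h _ (hY h1) _ h2).le h3.2
    · exact absurd (h _ h2 _ (hZ h1)).le h3.1
    · exact Or.inr ⟨h1, h2, h3⟩
  · exact fun p hp q hq hpq => hpq.1 (h _ (hY hp.1) _ (hZ hq.1)).le

theorem otype_union_le_add {A B : Set X} (h : ∀ a ∈ A, ∀ b ∈ B, a < b) :
    otype (A ∪ B) ≤ otype A + otype B :=
  seqRank_union_le_add fun a ha b hb hab => hab (h a ha b hb).le

/-- A sequence descending along `ρ` is bad by monotonicity, and safety provides each term with a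
friend in the residual of the earlier ones. The list `l` in the induction records those earlier
terms. -/
theorem SafeLin.seqRank_le_frank {D S S' : Set X} {ρ : X → Ordinal.{u}} (h : SafeLin D S ρ)
    (hS : S' ⊆ S) : seqRank (Descends ρ) S' ≤ frank D S' := by
  suffices ∀ (T : Set X) (l : List X), T ⊆ S → (∀ y ∈ l, y ∈ S) →
      (∀ x ∈ T, ∀ y ∈ l, ρ x < ρ y) →
      seqRank (Descends ρ) T ≤ frank (D ∩ {z | ∀ y ∈ l, ¬ y ≤ z}) T by
    exact (this S' [] hS (by simp) (by simp)).trans (frank_mono inter_subset_left subset_rfl)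
  intro T
  induction T using residual_induction (Descends ρ) with
  | h T ih =>
    intro l hTS hl hlt
    rw [seqRank_le_iff]
    intro x hx
    obtain ⟨z, hz, hzl, hzx⟩ := h.safe l hl x (hTS hx) (hlt x hx)
    refine ((ih x hx (x :: l) (inter_subset_left.trans hTS) ?_ ?_).trans ?_).trans_lt
      (frank_avoid_lt hx ⟨hz, hzl⟩ hzx)
    · simp only [List.mem_cons, forall_eq_or_imp]
      exact ⟨hTS hx, hl⟩
    · simp only [List.mem_cons, forall_eq_or_imp]
      exact fun y hy => ⟨hy.2, hlt y hy.1⟩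
    · refine frank_mono ?_ ?_
      · rintro w ⟨hw, hw'⟩
        simp only [List.mem_cons, forall_eq_or_imp, mem_ofPred_eq] at hw'
        exact ⟨⟨hw, hw'.2⟩, hw'.1⟩
      · exact fun y hy => ⟨hy.1, fun hxy => (h.mono x (hTS hx) y (hTS hy.1) hxy).not_gt hy.2⟩

theorem seqRank_descends_le_otype {S : Set X} {ρ : X → Ordinal.{u}}
    (h : ∀ x ∈ S, ∀ y ∈ S, x ≤ y → ρ x ≤ ρ y) : seqRank (Descends ρ) S ≤ otype S :=
  seqRank_le_of_mapsTo id (mapsTo_id S) fun x hx y hy hxy hle => (h x hx y hy hle).not_gt hxy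

theorem maxOrderType_le_frank_of_isSafe {S : Set X} (hS : IsSafe S) :
    maxOrderType S ≤ frank (univ : Set X) univ := by
  classical
  obtain ⟨e, hmono, hsafe⟩ := hS
  -- The value 0 outside `S` plays no role.
  set ρ : X → Ordinal.{u} := fun x => if h : x ∈ S then (e ⟨x, h⟩ : Ordinal.{u}) else 0 with hρ
  have hρS : ∀ x (h : x ∈ S), ρ x = e ⟨x, h⟩ := fun x h => by simp [hρ, h]
  have hlin : SafeLin univ S ρ := by
    refine ⟨fun x hx y hy hxy => ?_, fun x hx y hy hxy => ?_, fun l hl x hx hlt => ?_⟩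
    · rw [hρS x hx, hρS y hy] at hxy
      exact congrArg Subtype.val (e.injective (Subtype.ext hxy))
    · rw [hρS x hx, hρS y hy]
      exact hmono (show (⟨x, hx⟩ : S) ≤ ⟨y, hy⟩ from hxy)
    · obtain ⟨z, hz, hzx⟩ := hsafe (l.toFinset.subtype (· ∈ S)) ⟨x, hx⟩ fun y hy => by
        have hy' : (y : X) ∈ l := by simpa using hy
        have := hlt y hy'
        rw [hρS x hx, hρS y y.2] at this
        exact this
      exact ⟨z, mem_univ z, fun y hy => hz ⟨y, hl y hy⟩ (by simpa using hy), hzx⟩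
  have key : ∀ a ≤ maxOrderType S, a ≤ seqRank (Descends ρ) (S ∩ {x | ρ x < a}) := by
    intro a
    induction a using WellFoundedLT.induction with
    | ind a ih =>
      intro ha
      refine le_of_forall_lt fun b hb => ?_
      have hx := (e.symm ⟨b, hb.trans_le ha⟩).2
      have hxb : ρ (e.symm ⟨b, hb.trans_le ha⟩) = b := by
        rw [hρS _ hx]
        simp
      refine (ih b hb (hb.le.trans ha)).trans_lt
        (seqRank_lt_of_subset_residual (x := (e.symm ⟨b, hb.trans_le ha⟩ : X)) ⟨hx, ?_⟩ ?_)
      · rw [mem_ofPred_eq, hxb]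
        exact hb
      · rintro y ⟨hy, hyb⟩
        refine ⟨⟨hy, lt_trans hyb hb⟩, ?_⟩
        rw [mem_ofPred_eq, Descends, hxb]
        exact hyb
  calc maxOrderType S ≤ _ := key _ le_rfl
    _ ≤ seqRank (Descends ρ) S := seqRank_mono inter_subset_left
    _ ≤ frank univ S := hlin.seqRank_le_frank subset_rfl
    _ ≤ _ := frank_mono subset_rfl (subset_univ _)

/-- The values of `ρ` may have gaps. The map `σ` collapses them by sending `x` to the order type of
the part of `S` below `x` along `ρ`; its range is the initial segment of length `seqRank (Descends
ρ) S`, which is squeezed to the maximal order type. -/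
theorem isSafe_of_safeLin {S : Set X} {ρ : X → Ordinal.{u}} (h : SafeLin univ S ρ)
    (hle : otype S ≤ seqRank (Descends ρ) S) : IsSafe S := by
  have heq : maxOrderType S = seqRank (Descends ρ) S :=
    (maxOrderType_coe S).trans (le_antisymm hle (seqRank_descends_le_otype h.mono))
  set σ : X → Ordinal.{u} := fun x => seqRank (Descends ρ) (S ∩ {y | Descends ρ x y}) with hσ
  have hσlt : ∀ x ∈ S, ∀ y ∈ S, ρ x < ρ y → σ x < σ y := fun x hx y hy hxy =>
    seqRank_lt_of_subset_residual (x := x) ⟨hx, hxy⟩ fun z hz =>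
      ⟨⟨hz.1, lt_trans hz.2 hxy⟩, hz.2⟩
  have hσiff : ∀ x ∈ S, ∀ y ∈ S, σ x < σ y → ρ x < ρ y := by
    intro x hx y hy hxy
    rcases lt_trichotomy (ρ x) (ρ y) with h1 | h1 | h1
    · exact h1
    · rw [h.injOn hx hy h1] at hxy
      exact absurd hxy (lt_irrefl _)
    · exact absurd hxy (hσlt y hy x hx h1).not_gt
  let f : S → Set.Iio (maxOrderType S) := fun x =>
    ⟨σ x, by rw [heq]; exact seqRank_residual_lt x.2⟩
  have hinj : Function.Injective f := by
    intro x y hxy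
    have hxy' : σ x = σ y := congrArg Subtype.val hxy
    rcases lt_trichotomy (ρ x) (ρ y) with h1 | h1 | h1
    · exact absurd hxy' (hσlt x x.2 y y.2 h1).ne
    · exact Subtype.ext (h.injOn x.2 y.2 h1)
    · exact absurd hxy' (hσlt y y.2 x x.2 h1).ne'
  have hsurj : Function.Surjective f := by
    rintro ⟨a, ha⟩
    rw [mem_Iio, heq] at ha
    obtain ⟨x, ⟨hx, hax⟩, hmin⟩ : ∃ x ∈ {x | x ∈ S ∧ a ≤ σ x}, ∀ y ∈ {x | x ∈ S ∧ a ≤ σ x},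
        ¬ ρ y < ρ x := by
      obtain ⟨x, hx, hax⟩ := lt_seqRank_iff.1 ha
      exact (InvImage.wf ρ (wellFounded_lt (α := Ordinal.{u}))).has_min _ ⟨x, hx, hax⟩
    refine ⟨⟨x, hx⟩, Subtype.ext (le_antisymm ?_ hax)⟩
    by_contra! hlt
    obtain ⟨y, hy, hay⟩ := lt_seqRank_iff.1 hlt
    refine hmin y ⟨hy.1, hay.trans (seqRank_mono ?_)⟩ hy.2
    exact fun z hz => ⟨hz.1.1, hz.2⟩
  refine ⟨Equiv.ofBijective f ⟨hinj, hsurj⟩, fun x y hxy => ?_, fun F x hx => ?_⟩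
  · by_contra! hlt
    exact (h.mono x x.2 y y.2 hxy).not_gt (hσiff y y.2 x x.2 hlt)
  · obtain ⟨z, -, hz, hzx⟩ := h.safe (F.toList.map Subtype.val) (by simp +contextual)
      x x.2 fun y hy => by
        obtain ⟨y, hyF, rfl⟩ := List.mem_map.1 hy
        exact hσiff x x.2 y y.2 (hx y (Finset.mem_toList.1 hyF))
    exact ⟨z, fun y hy => hz y (List.mem_map.2 ⟨y, Finset.mem_toList.2 hy, rfl⟩), hzx⟩

end Friendly

/-! ### Safe linearisations of maximal length -/

section Existence

/-- Recursive choice in which the requirement at `i` refers to the values already chosen. By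
`hcongr` it sees only those, so the partial family may be completed arbitrarily. -/
theorem exists_of_wellFounded {ι α : Type*} [Nonempty α] {r : ι → ι → Prop} (hr : WellFounded r)
    (P : ι → (ι → α) → α → Prop)
    (hcongr : ∀ i x x' y, (∀ j, r j i → x j = x' j) → P i x y → P i x' y)
    (h : ∀ i x, (∀ j, r j i → P j x (x j)) → ∃ y, P i x y) :
    ∃ x : ι → α, ∀ i, P i x (x i) := by
  classical
  let ext : ∀ i, (∀ j, r j i → α) → ι → α := fun i xs j =>
    if hj : r j i then xs j hj else Classical.arbitrary α
  let F : ∀ i, (∀ j, r j i → α) → α := fun i xs => Classical.epsilon (P i (ext i xs))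
  let x : ι → α := hr.fix F
  have hx : ∀ i, x i = Classical.epsilon (P i (ext i fun j _ => x j)) := fun i => hr.fix_eq F i
  have hext : ∀ i j, r j i → ext i (fun j _ => x j) j = x j := fun i j hj => by simp [ext, hj]
  refine ⟨x, fun i => ?_⟩
  induction i using hr.induction with
  | _ i ih =>
    obtain ⟨y, hy⟩ := h i x ih
    refine hcongr i (ext i fun j _ => x j) x (x i) (fun j hj => hext i j hj) ?_
    rw [hx i]
    exact Classical.epsilon_spec ⟨y, hcongr i x _ y (fun j hj => (hext i j hj).symm) hy⟩

/-- Isolates one copy of the last power in the Cantor normal form, by removing leading terms until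
the remainder vanishes. -/
theorem Ordinal.exists_eq_omega0_opow_mul_add_one (a : Ordinal.{u}) (ha : a ≠ 0) :
    ∃ e g : Ordinal.{u}, a = ω ^ e * (g + 1) := by
  induction a using WellFoundedLT.induction with
  | ind a ih =>
    have hdm := Ordinal.div_add_mod a (ω ^ Ordinal.log ω a)
    set e := Ordinal.log ω a with he
    have hpos : (0 : Ordinal.{u}) < ω ^ e := Ordinal.opow_pos _ Ordinal.omega0_pos
    by_cases hr : a % ω ^ e = 0
    · rw [hr, add_zero] at hdm
      obtain ⟨n, hn⟩ := Ordinal.lt_omega0.1 (Ordinal.div_opow_log_lt a Ordinal.one_lt_omega0)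
      cases n with
      | zero =>
        rw [← he] at hn
        rw [hn] at hdm
        simp only [Nat.cast_zero, mul_zero] at hdm
        exact absurd hdm.symm ha
      | succ n =>
        refine ⟨e, n, ?_⟩
        rw [← he] at hn
        rw [hn] at hdm
        rw [← hdm, Nat.cast_add, Nat.cast_one]
    · have hlt : a % ω ^ e < a := Ordinal.mod_opow_log_lt_self ω ha
      obtain ⟨e', g, hg⟩ := ih _ hlt hr
      have hee : e' ≤ e := by
        by_contra! hlt'
        have h1 : (ω : Ordinal.{u}) ^ e' ≤ a % ω ^ e := by
          rw [hg]
          exact Ordinal.le_mul_left _ (by simp)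
        have h2 : (ω : Ordinal.{u}) ^ e ≤ ω ^ e' :=
          Ordinal.opow_le_opow_right Ordinal.omega0_pos hlt'.le
        exact ((h2.trans h1).trans_lt (Ordinal.mod_lt a hpos.ne')).false
      refine ⟨e', ω ^ (e - e') * (a / ω ^ e) + g, ?_⟩
      have h3 : (ω : Ordinal.{u}) ^ e = ω ^ e' * ω ^ (e - e') := by
        rw [← Ordinal.opow_add, Ordinal.add_sub_cancel_of_le hee]
      rw [add_assoc, mul_add, ← hg, ← mul_assoc, ← h3, hdm]

variable {X : Type u} [PartialOrder X]

/-- Blocks are linearised lexicographically, `W` being an upper bound for all positions inside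
blocks. The witness for `x` comes from its own block: safety there handles the listed elements of
that block, and `havoid` those of higher blocks. -/
theorem SafeLin.glue {I : Type*} {c : I → Ordinal.{u}} (hc : Function.Injective c) (idx : X → I)
    {D S : Set X} {E : I → Set X} {σ : I → X → Ordinal.{u}}
    (hmono : ∀ x ∈ S, ∀ y ∈ S, x ≤ y → c (idx x) ≤ c (idx y))
    (hσ : ∀ i, SafeLin (E i) (S ∩ {x | idx x = i}) (σ i)) (hE : ∀ i, E i ⊆ D)
    (havoid : ∀ i, ∀ x ∈ S, c i < c (idx x) → ∀ z ∈ E i, ¬ x ≤ z) :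
    ∃ ρ : X → Ordinal.{u}, SafeLin D S ρ ∧ (∀ x y, c (idx x) < c (idx y) → ρ x < ρ y) ∧
      ∀ x y, idx x = idx y → (ρ x < ρ y ↔ σ (idx x) x < σ (idx x) y) := by
  set W : Ordinal.{u} := ⨆ x : X, Order.succ (σ (idx x) x) with hW
  have hWlt : ∀ x, σ (idx x) x < W := fun x =>
    (Order.lt_succ _).trans_le (Ordinal.le_iSup (fun x : X => Order.succ (σ (idx x) x)) x)
  set ρ : X → Ordinal.{u} := fun x => W * c (idx x) + σ (idx x) x with hρ
  have hlt : ∀ x y, c (idx x) < c (idx y) → ρ x < ρ y := by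
    intro x y hxy
    calc ρ x < W * c (idx x) + W := add_lt_add_right (hWlt x) _
      _ = W * (c (idx x) + 1) := by rw [mul_add, mul_one]
      _ ≤ W * c (idx y) := by gcongr; exact Order.add_one_le_of_lt hxy
      _ ≤ ρ y := le_self_add
  have heq : ∀ x y, idx x = idx y → (ρ x < ρ y ↔ σ (idx x) x < σ (idx x) y) := by
    intro x y hxy
    simp only [hρ, ← hxy]
    exact add_lt_add_iff_left _
  have hle : ∀ x y, ρ x ≤ ρ y → c (idx x) ≤ c (idx y) := fun x y hxy => by
    by_contra! h
    exact (hlt y x h).not_ge hxy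
  refine ⟨ρ, ⟨fun x hx y hy hxy => ?_, fun x hx y hy hxy => ?_, fun l hl x hx hlx => ?_⟩, hlt, heq⟩
  · have hi : idx x = idx y := hc (le_antisymm (hle x y hxy.le) (hle y x hxy.ge))
    refine (hσ (idx x)).injOn ⟨hx, rfl⟩ ⟨hy, hi.symm⟩ ?_
    simp only [hρ, ← hi] at hxy
    exact add_left_cancel hxy
  · rcases (hmono x hx y hy hxy).lt_or_eq with h | h
    · exact (hlt x y h).le
    · have hi := hc h
      have h1 := (hσ (idx x)).mono x ⟨hx, rfl⟩ y ⟨hy, hi.symm⟩ hxy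
      exact not_lt.1 fun h2 => ((heq y x hi.symm).1 h2).not_ge (by rwa [← hi])
  · classical
    obtain ⟨z, hz, hzl, hzx⟩ := (hσ (idx x)).safe (l.filter (fun y => idx y = idx x))
      (fun y hy => by
        rw [List.mem_filter] at hy
        exact ⟨hl y hy.1, by simpa using hy.2⟩) x ⟨hx, rfl⟩ (fun y hy => by
        rw [List.mem_filter] at hy
        have hi : idx x = idx y := (of_decide_eq_true hy.2).symm
        exact (heq x y hi).1 (hlx y hy.1))
    refine ⟨z, hE _ hz, fun y hy => ?_, hzx⟩
    by_cases hi : idx y = idx x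
    · exact hzl y (List.mem_filter.2 ⟨hy, by simpa using hi⟩)
    · exact havoid (idx x) y (hl y hy)
        (lt_of_le_of_ne (hle x y (hlx y hy).le) fun h => hi (hc h).symm) z hz

/-- Two blocks, `S` below `S'`. Witnesses for `S` are not above `y`, so they are not above any
element of `S'`. -/
theorem SafeLin.exists_append {D S S' : Set X} {y : X} {σ σ' : X → Ordinal.{u}}
    (h : SafeLin (avoid D y) S σ) (hS : ∀ x ∈ S, ¬ y ≤ x) (h' : SafeLin D S' σ')
    (hS' : ∀ x ∈ S', y ≤ x) :
    ∃ ρ, SafeLin D (S ∪ S') ρ ∧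
      seqRank (Descends σ) S + seqRank (Descends σ') S' ≤ seqRank (Descends ρ) (S ∪ S') := by
  classical
  have hidx : ∀ x ∈ S, decide (y ≤ x) = false := fun x hx => by simpa using hS x hx
  have hidx' : ∀ x ∈ S', decide (y ≤ x) = true := fun x hx => by simpa using hS' x hx
  obtain ⟨ρ, hρ, hlt, heq⟩ := SafeLin.glue (c := fun b : Bool => if b then (1 : Ordinal.{u}) else 0)
    (by intro a b; cases a <;> cases b <;> simp) (fun x => decide (y ≤ x)) (D := D) (S := S ∪ S')
    (E := fun b => if b then D else avoid D y) (σ := fun b => if b then σ' else σ)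
    (by
      intro a _ b _ hab
      by_cases hy : y ≤ a
      · simp [hy, hy.trans hab]
      · simp [hy])
    (by
      rintro (_ | _)
      · refine h.subset (by simp) ?_
        rintro x ⟨hx | hx, hx'⟩
        · exact hx
        · exact absurd (hS' x hx) (by simpa using hx')
      · refine h'.subset (by simp) ?_
        rintro x ⟨hx | hx, hx'⟩
        · exact absurd (by simpa using hx') (hS x hx)
        · exact hx)
    (by rintro (_ | _) <;> simp)
    (by
      rintro (_ | _) x - hx z hz hxz
      · by_cases hy : y ≤ x
        · exact (show z ∈ avoid D y by simpa using hz).2 (hy.trans hxz)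
        · simp [hy] at hx
      · by_cases hy : y ≤ x <;> simp [hy] at hx)
  refine ⟨ρ, hρ, le_trans (add_le_add ?_ ?_) (seqRank_add_le_union fun a ha b hb => hlt a b ?_)⟩
  · refine seqRank_le_of_mapsTo id (mapsTo_id _) fun a ha b hb hab => ?_
    have := heq b a (by rw [hidx a ha, hidx b hb])
    simp only [hidx b hb] at this
    exact this.2 hab
  · refine seqRank_le_of_mapsTo id (mapsTo_id _) fun a ha b hb hab => ?_
    have := heq b a (by rw [hidx' a ha, hidx' b hb])
    simp only [hidx' b hb] at this
    exact this.2 hab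
  · simp [hidx a ha, hidx' b hb]

variable [WellQuasiOrderedLE X]

theorem exists_minimal_subset (P : Set X → Prop) {Y : Set X} (hY : P Y) :
    ∃ Y' ⊆ Y, P Y' ∧ ∀ y ∈ Y', ∀ Z ⊆ avoid Y' y, ¬ P Z := by
  obtain ⟨Y', ⟨hsub, hP⟩, hmin⟩ := (InvImage.wf (fun A : Set X => otype {x | ∃ a ∈ A, x ≤ a})
    (wellFounded_lt (α := Ordinal.{u}))).has_min {A | A ⊆ Y ∧ P A} ⟨Y, subset_rfl, hY⟩
  refine ⟨Y', hsub, hP, fun y hy Z hZ hPZ =>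
    hmin Z ⟨hZ.trans (inter_subset_left.trans hsub), hPZ⟩ ?_⟩
  refine seqRank_lt_of_subset_residual (x := y) ⟨y, hy, le_rfl⟩ ?_
  rintro x ⟨a, ha, hxa⟩
  exact ⟨⟨a, (hZ ha).1, hxa⟩, fun hyx => (hZ ha).2 (hyx.trans hxa)⟩

/-- A cofinal subset of least cardinality is enumerated in its initial order type, so proper initial
segments have fewer than `cof b` elements and families over them are bounded. -/
theorem exists_cofinal_family {b : Ordinal.{u}} :
    ∃ (ι : Type u) (r : ι → ι → Prop) (_ : IsWellOrder ι r) (g : ι → Ordinal.{u}),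
      (∀ i, g i < b) ∧ (∀ a < b, ∃ i, a ≤ g i) ∧
      ∀ (i : ι) (f : {j // r j i} → Ordinal.{u}), (∀ j, f j < b) → ∃ c < b, ∀ j, f j ≤ c := by
  obtain ⟨s, hs, hcard⟩ := Order.exists_cof_eq b.ToType
  obtain ⟨r, wo, hr⟩ := Cardinal.exists_ord_eq s
  refine ⟨s, r, wo, fun i => (i : b.ToType).toOrd, fun i => (i : b.ToType).toOrd.2,
    fun a ha => ?_, fun i f hf => ?_⟩
  · obtain ⟨x, hx, hax⟩ := hs (Ordinal.ToType.mk ⟨a, ha⟩)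
    refine ⟨⟨x, hx⟩, ?_⟩
    have := Ordinal.ToType.mk.symm.monotone hax
    rwa [OrderIso.symm_apply_apply] at this
  · refine ⟨⨆ j, f j, Ordinal.iSup_lt_of_lt_cof ?_ hf, fun j => Ordinal.le_iSup f j⟩
    rw [← Ordinal.cof_toType, ← hcard]
    exact Cardinal.card_typein_lt i hr

/-- The linearisation is a transfinite concatenation of blocks `P i` of lengths cofinal in `ω ^ e`.
An increasing family `x i` separates them: `P i` lies above all earlier `x j` but avoids `x i`, and
so do its witnesses. -/
theorem exists_safeLin_opow {e : Ordinal.{u}} (he : e ≠ 0) {D Y : Set X} (hle : ω ^ e ≤ frank D Y)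
    (ih : ∀ a < (ω : Ordinal.{u}) ^ e, ∀ D Y : Set X, a ≤ frank D Y →
      ∃ S ⊆ Y, ∃ ρ, SafeLin D S ρ ∧ a ≤ seqRank (Descends ρ) S) :
    ∃ S ⊆ Y, ∃ ρ, SafeLin D S ρ ∧ ω ^ e ≤ seqRank (Descends ρ) S := by
  have hlim : Order.IsSuccLimit ((ω : Ordinal.{u}) ^ e) :=
    Ordinal.isSuccLimit_opow_left Ordinal.isSuccLimit_omega0 he
  obtain ⟨Y, hYY, hY, hYmin⟩ := exists_minimal_subset (fun Z => ω ^ e ≤ frank D Z) hle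
  suffices ∃ S ⊆ Y, ∃ ρ, SafeLin D S ρ ∧ ω ^ e ≤ seqRank (Descends ρ) S by
    obtain ⟨S, hS, h⟩ := this
    exact ⟨S, hS.trans hYY, h⟩
  have hsmall : ∀ y ∈ Y, frank D (avoid Y y) < ω ^ e := fun y hy =>
    not_le.1 (hYmin y hy _ subset_rfl)
  set h : X → Ordinal.{u} := fun x => frank (avoid D x) (avoid Y x) with hh
  obtain ⟨T, hTY, hT, hTmin⟩ := exists_minimal_subset
    (fun Z => ∀ b < (ω : Ordinal.{u}) ^ e, ∃ x ∈ Z, b ≤ h x) (Y := Y) (fun b hb => by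
      obtain ⟨x, hx, -, hbx⟩ := lt_frank_iff.1 (hb.trans_le hY)
      exact ⟨x, hx, hbx⟩)
  -- By minimality of `T`, `h` is bounded on the part of `T` not above `y`.
  have hB : ∀ y, ∃ b < (ω : Ordinal.{u}) ^ e, y ∈ T → ∀ x ∈ T, b ≤ h x → y ≤ x := by
    intro y
    by_cases hy : y ∈ T
    · have := hTmin y hy _ subset_rfl
      push Not at this
      obtain ⟨b, hb, hb'⟩ := this
      refine ⟨b, hb, fun _ x hx hbx => ?_⟩
      by_contra hyx
      exact (hb' x ⟨hx, hyx⟩).not_ge hbx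
    · exact ⟨0, hlim.bot_lt, fun h => absurd h hy⟩
  choose B hBlt hB using hB
  obtain ⟨ι, r, wo, g, hglt, hgcof, hsup⟩ := exists_cofinal_family (b := (ω : Ordinal.{u}) ^ e)
  let U : ι → (ι → X) → Set X := fun i x => {w | w ∈ Y ∧ ∃ j, r j i ∧ ¬ x j ≤ w}
  have hne : Nonempty X := by
    obtain ⟨x, -⟩ := hT 0 hlim.bot_lt
    exact ⟨x⟩
  obtain ⟨x, hx⟩ := exists_of_wellFounded wo.wf
    -- The term `frank D (U i x)` pays for the elements not above all earlier `x j`, which are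
    -- discarded later; `g i` is what must survive.
    (fun i x y => y ∈ T ∧ (∀ j, r j i → x j ≤ y) ∧ natSum (frank D (U i x)) (g i) ≤ h y ∧
      natSum (frank D (U i x)) (g i) < ω ^ e) (by
      rintro i x x' y hxx ⟨h1, h2, h3⟩
      have hU : U i x = U i x' := by
        ext w
        simp only [U, mem_ofPred_eq]
        refine and_congr_right fun _ => exists_congr fun j => and_congr_right fun hj => ?_
        rw [hxx j hj]
      rw [hU] at h3
      exact ⟨h1, fun j hj => hxx j hj ▸ h2 j hj, h3⟩) (by
      intro i x hx
      obtain ⟨c, hc, hcB⟩ := hsup i (fun j => B (x j)) fun j => hBlt _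
      obtain ⟨y₀, hy₀, hcy₀⟩ := hT c hc
      have hle₀ : ∀ j, r j i → x j ≤ y₀ := fun j hj =>
        hB _ (hx j hj).1 y₀ hy₀ ((hcB ⟨j, hj⟩).trans hcy₀)
      -- All earlier `x j` lie below the single `y₀`, so `U i x` is contained in `avoid Y y₀`, which
      -- is small by minimality of `Y`.
      have hU : frank D (U i x) < ω ^ e := by
        refine (frank_mono subset_rfl ?_).trans_lt (hsmall y₀ (hTY hy₀))
        rintro w ⟨hw, j, hj, hjw⟩
        exact ⟨hw, fun hyw => hjw ((hle₀ j hj).trans hyw)⟩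
      have hN := natSum_lt_opow hU (hglt i)
      obtain ⟨y, hy, hcy⟩ := hT (max c (natSum (frank D (U i x)) (g i))) (max_lt hc hN)
      exact ⟨y, hy, fun j hj => hB _ (hx j hj).1 y hy
        ((hcB ⟨j, hj⟩).trans ((le_max_left _ _).trans hcy)), (le_max_right _ _).trans hcy, hN⟩)
  choose S hSY σ hσ hSle using fun i => ih _ (hx i).2.2.2 _ _ (hx i).2.2.1
  let P : ι → Set X := fun i => S i \ U i x
  have hPge : ∀ i w, w ∈ P i → ∀ j, r j i → x j ≤ w := fun i w hw j hj => by
    by_contra hjw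
    exact hw.2 ⟨(hSY i hw.1).1, j, hj, hjw⟩
  have hPnot : ∀ i w, w ∈ P i → ¬ x i ≤ w := fun i w hw => (hSY i hw.1).2
  have hPmono : ∀ i j w w', w ∈ P i → w' ∈ P j → w ≤ w' → ¬ r j i := fun i j w w' hw hw' hle hji =>
    hPnot j w' hw' ((hPge i w hw j hji).trans hle)
  have hPuniq : ∀ i j w, w ∈ P i → w ∈ P j → i = j := fun i j w hi hj => by
    rcases trichotomous_of r i j with h | h | h
    · exact absurd h (hPmono j i w w hj hi le_rfl)
    · exact h
    · exact absurd h (hPmono i j w w hi hj le_rfl)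
  have hPrank : ∀ i, g i ≤ seqRank (Descends (σ i)) (P i) := by
    intro i
    by_contra! hlt
    have h1 : seqRank (Descends (σ i)) (S i) ≤
        natSum (seqRank (Descends (σ i)) (S i ∩ U i x)) (seqRank (Descends (σ i)) (P i)) := by
      rw [← inter_union_sdiff (S i) (U i x)]
      refine (seqRank_union_le _ _).trans_eq ?_
      rw [inter_union_sdiff (S i) (U i x)]
    have h2 : seqRank (Descends (σ i)) (S i ∩ U i x) ≤ frank D (U i x) :=
      ((hσ i).seqRank_le_frank inter_subset_left).trans
        (frank_mono inter_subset_left inter_subset_right)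
    exact (((hSle i).trans h1).trans (natSum_mono h2 le_rfl)).not_gt (natSum_lt_right _ hlt)
  obtain ⟨i₀, -⟩ := hgcof 0 hlim.bot_lt
  have : ∀ w, ∃ i, (∃ j, w ∈ P j) → w ∈ P i := fun w => by
    by_cases hw : ∃ j, w ∈ P j
    · exact hw.imp fun _ h _ => h
    · exact ⟨i₀, fun h => absurd h hw⟩
  choose idx hidx using this
  have hidx' : ∀ i w, w ∈ P i → idx w = i := fun i w hw => hPuniq _ _ w (hidx w ⟨i, hw⟩) hw
  have hc : ∀ i j, Ordinal.typein r i < Ordinal.typein r j ↔ r i j := fun i j =>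
    Ordinal.typein_lt_typein r
  obtain ⟨ρ, hρ, -, heq⟩ := SafeLin.glue (Ordinal.typein_injective r) idx (D := D)
    (S := {w | ∃ i, w ∈ P i}) (E := fun i => avoid D (x i)) (σ := σ)
    (by
      rintro w ⟨i, hi⟩ w' ⟨j, hj⟩ hww
      rw [← not_lt, hc, hidx' i w hi, hidx' j w' hj]
      exact hPmono i j w w' hi hj hww)
    (by
      intro i
      refine (hσ i).subset subset_rfl ?_
      rintro w ⟨hw, rfl⟩
      exact (hidx w hw).1)
    (fun i => inter_subset_left)
    (by
      rintro i w hw hi z hz hwz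
      exact hz.2 ((hPge _ w (hidx w hw) i ((hc _ _).1 hi)).trans hwz))
  refine ⟨_, ?_, ρ, hρ, ?_⟩
  · rintro w ⟨i, hi⟩
    exact (hSY i hi.1).1
  · refine le_of_forall_lt fun b hb => ?_
    obtain ⟨i, hi⟩ := hgcof _ (hlim.succ_lt hb)
    refine (Order.lt_succ b).trans_le ((hi.trans (hPrank i)).trans ?_)
    refine seqRank_le_of_mapsTo id (fun w hw => ⟨i, hw⟩) fun a ha b hb hab => ?_
    have := heq b a (by rw [hidx' i a ha, hidx' i b hb])
    rw [hidx' i b hb] at this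
    exact this.2 hab

/-- Split `a = ω ^ e * g + ω ^ e`. When `g ≠ 0`, a suitable `y` in a minimal `Y` leaves rank `ω ^ e
* g` in the part avoiding `y`, and the part above `y` supplies the final `ω ^ e`. -/
theorem exists_safeLin (a : Ordinal.{u}) (D Y : Set X) (ha : a ≤ frank D Y) :
    ∃ S ⊆ Y, ∃ ρ, SafeLin D S ρ ∧ a ≤ seqRank (Descends ρ) S := by
  induction a using WellFoundedLT.induction generalizing D Y with
  | ind a ih =>
    by_cases ha0 : a = 0
    · exact ⟨∅, empty_subset _, fun _ => 0, ⟨by simp, by simp, by simp⟩, by simp [ha0]⟩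
    obtain ⟨e, g, rfl⟩ := Ordinal.exists_eq_omega0_opow_mul_add_one a ha0
    have hpos : (0 : Ordinal.{u}) < ω ^ e := Ordinal.opow_pos _ Ordinal.omega0_pos
    by_cases hg : g = 0
    · subst hg
      rw [zero_add, mul_one] at ha ih ⊢
      by_cases he : e = 0
      · subst he
        rw [Ordinal.opow_zero] at ha ⊢
        obtain ⟨x, hx, ⟨z, hz, hzx⟩, -⟩ := lt_frank_iff.1 (zero_lt_one.trans_le ha)
        refine ⟨{x}, by simpa using hx, fun _ => 0, ⟨by simp, by simp, ?_⟩, ?_⟩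
        · intro l hl y hy hly
          rw [mem_singleton_iff.1 hy]
          exact ⟨z, hz, fun w hw => absurd (hly w hw) (lt_irrefl _), hzx⟩
        · rw [Order.one_le_iff_pos]
          exact seqRank_pos (singleton_nonempty x)
      · exact exists_safeLin_opow he ha ih
    · obtain ⟨Y, hYY, hY, hYmin⟩ :=
        exists_minimal_subset (fun Z => ω ^ e * (g + 1) ≤ frank D Z) ha
      have hlt : ω ^ e * g < ω ^ e * (g + 1) := by
        gcongr
        exact Order.lt_add_one_iff.2 le_rfl
      have hlt' : ω ^ e < ω ^ e * (g + 1) := by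
        conv_lhs => rw [← mul_one (ω ^ e)]
        gcongr
        exact Order.lt_add_one_iff.2 (Order.one_le_iff_pos.2 (pos_iff_ne_zero.2 hg))
      obtain ⟨y, hy, -, hgy⟩ := lt_frank_iff.1 (hlt.trans_le hY)
      have h1 : frank D (avoid Y y) < ω ^ e * (g + 1) := not_le.1 (hYmin y hy _ subset_rfl)
      -- Otherwise the natural sum of the two parts of `Y` would stay below `ω ^ e * (g + 1)`.
      have h2 : ω ^ e ≤ frank D (Y ∩ {x | y ≤ x}) := by
        by_contra! h2
        refine (hY.trans (le_trans (frank_mono subset_rfl ?_) (frank_union_le D _ _))).not_gt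
          (natSum_lt_opow_mul e (g + 1) _ _ h1 h2)
        intro x hx
        by_cases hyx : y ≤ x
        · exact Or.inr ⟨hx, hyx⟩
        · exact Or.inl ⟨hx, hyx⟩
      obtain ⟨S, hS, σ, hσ, hle⟩ := ih _ hlt _ _ hgy
      obtain ⟨S', hS', σ', hσ', hle'⟩ := ih _ hlt' _ _ h2
      obtain ⟨ρ, hρ, hρle⟩ := hσ.exists_append (fun x hx => (hS hx).2) hσ' fun x hx => (hS' hx).2
      refine ⟨S ∪ S', ?_, ρ, hρ, ?_⟩
      · exact union_subset (hS.trans (inter_subset_left.trans hYY))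
          (hS'.trans (inter_subset_left.trans hYY))
      · rw [mul_add, mul_one]
        exact (add_le_add hle hle').trans hρle

end Existence

/-! ### Decomposition into ordinal sums -/

section Cuts

variable {X : Type u} [PartialOrder X]

/-- `D` is the ordinal sum of `A` and `D \ A`. -/
structure IsCut (D A : Set X) : Prop where
  subset : A ⊆ D
  lt : ∀ a ∈ A, ∀ b ∈ D, b ∉ A → a < b

/-- `D` is not an ordinal sum of two nonempty sets. -/
def SumIndecomposable (D : Set X) : Prop := ∀ A, IsCut D A → A.Nonempty → A = D

/-- The least cut of `D` containing `x`. -/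
def cutGE (D : Set X) (x : X) : Set X := {w | ∀ A, IsCut D A → x ∈ A → w ∈ A}

/-- The greatest cut of `D` not containing `x`. -/
def cutLT (D : Set X) (x : X) : Set X := {w | ∃ A, IsCut D A ∧ x ∉ A ∧ w ∈ A}

/-- The indecomposable summand of `D` containing `x`. -/
def summand (D : Set X) (x : X) : Set X := cutGE D x \ cutLT D x

theorem IsCut.self (D : Set X) : IsCut D D := ⟨subset_rfl, fun _ _ _ hb hb' => absurd hb hb'⟩

theorem IsCut.subset_or_subset {D A B : Set X} (hA : IsCut D A) (hB : IsCut D B) :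
    A ⊆ B ∨ B ⊆ A := by
  by_contra! h
  obtain ⟨⟨a, haA, haB⟩, ⟨b, hbB, hbA⟩⟩ := And.intro (not_subset.1 h.1) (not_subset.1 h.2)
  exact (hA.lt a haA b (hB.subset hbB) hbA).asymm (hB.lt b hbB a (hA.subset haA) haB)

theorem IsCut.cutGE {D : Set X} {x : X} (hx : x ∈ D) : IsCut D (cutGE D x) := by
  refine ⟨fun w hw => hw D (IsCut.self D) hx, fun a ha b hb hb' => ?_⟩
  simp only [_root_.cutGE, mem_ofPred_eq] at hb'
  push Not at hb'
  obtain ⟨A, hA, hxA, hbA⟩ := hb'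
  exact hA.lt a (ha A hA hxA) b hb hbA

theorem IsCut.cutLT (D : Set X) (x : X) : IsCut D (cutLT D x) := by
  refine ⟨?_, ?_⟩
  · rintro w ⟨A, hA, -, hw⟩
    exact hA.subset hw
  · rintro a ⟨A, hA, hxA, ha⟩ b hb hb'
    exact hA.lt a ha b hb fun h => hb' ⟨A, hA, hxA, h⟩

theorem notMem_cutLT_self (D : Set X) (x : X) : x ∉ cutLT D x := fun ⟨_, _, h, h'⟩ => h h'

theorem mem_cutGE_self (D : Set X) (x : X) : x ∈ cutGE D x := fun _ _ h => h

theorem mem_summand_self (D : Set X) (x : X) : x ∈ summand D x :=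
  ⟨mem_cutGE_self D x, notMem_cutLT_self D x⟩

theorem cutLT_subset_cutGE (D : Set X) (x : X) : cutLT D x ⊆ cutGE D x := by
  rintro w ⟨A, hA, hxA, hw⟩ B hB hxB
  exact (hA.subset_or_subset hB).elim (fun h => h hw) fun h => absurd (h hxB) hxA

theorem cutLT_union_summand (D : Set X) (x : X) : cutLT D x ∪ summand D x = cutGE D x :=
  union_sdiff_cancel (cutLT_subset_cutGE D x)

theorem summand_subset {D : Set X} {x : X} (hx : x ∈ D) : summand D x ⊆ D :=
  sdiff_subset.trans (IsCut.cutGE hx).subset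

theorem lt_of_mem_cutLT {D : Set X} {x a b : X} (hx : x ∈ D) (ha : a ∈ cutLT D x)
    (hb : b ∈ summand D x) : a < b :=
  (IsCut.cutLT D x).lt a ha b (summand_subset hx hb) hb.2

theorem summand_eq_of_mem {D : Set X} {x y : X} (hx : x ∈ D) (hy : y ∈ summand D x) :
    summand D y = summand D x := by
  have hyD : y ∈ D := summand_subset hx hy
  have h1 : ∀ A, IsCut D A → (x ∈ A ↔ y ∈ A) := fun A hA =>
    ⟨fun h => hy.1 A hA h, fun h => by
      by_contra h'
      exact hy.2 ⟨A, hA, h', h⟩⟩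
  have h2 : cutGE D y = cutGE D x := by
    ext w
    exact forall_congr' fun A => forall_congr' fun hA => by rw [h1 A hA]
  have h3 : cutLT D y = cutLT D x := by
    ext w
    exact exists_congr fun A => and_congr_right fun hA => by rw [h1 A hA]
  rw [summand, h2, h3, summand]

theorem SumIndecomposable.summand {D : Set X} {x : X} (hx : x ∈ D) :
    SumIndecomposable (summand D x) := by
  intro A hA hne
  have hcut : IsCut D (_root_.cutLT D x ∪ A) := by
    refine ⟨union_subset (IsCut.cutLT D x).subset (hA.subset.trans (summand_subset hx)), ?_⟩
    rintro a (ha | ha) b hb hb'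
    · exact (IsCut.cutLT D x).lt a ha b hb fun h => hb' (Or.inl h)
    · by_cases hbK : b ∈ _root_.cutGE D x
      · exact hA.lt a ha b ⟨hbK, fun h => hb' (Or.inl h)⟩ fun h => hb' (Or.inr h)
      · exact (IsCut.cutGE hx).lt a (hA.subset ha).1 b hb hbK
  by_cases hxA : x ∈ A
  · refine subset_antisymm hA.subset fun w hw => ?_
    exact (hw.1 _ hcut (Or.inr hxA)).resolve_left hw.2
  · obtain ⟨a, ha⟩ := hne
    exact absurd ⟨_, hcut, fun h => h.elim (notMem_cutLT_self D x) hxA, Or.inr ha⟩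
      (hA.subset ha).2

variable [WellQuasiOrderedLE X]

theorem exists_least_cut {D : Set X} (hD : D.Nonempty) :
    ∃ E, IsCut D E ∧ E.Nonempty ∧ SumIndecomposable E := by
  obtain ⟨E, ⟨hE, hne⟩, hmin⟩ := (InvImage.wf (otype (X := X))
    (wellFounded_lt (α := Ordinal.{u}))).has_min {A | IsCut D A ∧ A.Nonempty}
    ⟨D, IsCut.self D, hD⟩
  refine ⟨E, hE, hne, fun A hA hAne => subset_antisymm hA.subset ?_⟩
  by_contra hEA
  obtain ⟨e, he, heA⟩ := not_subset.1 hEA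
  have hcut : IsCut D A := ⟨hA.subset.trans hE.subset, fun a ha b hb hbA => by
    by_cases hbE : b ∈ E
    · exact hA.lt a ha b hbE hbA
    · exact hE.lt a (hA.subset ha) b hb hbE⟩
  exact hmin A ⟨hcut, hAne⟩ (seqRank_lt_of_subset_residual he fun a ha =>
    ⟨hA.subset ha, (hA.lt a ha e he heA).not_ge⟩)

/-- After a move `y`, let `E` be the least summand of `avoid D y`. Since `E` is not a cut of `D`,
some `z` above `y` fails to lie above some `e ∈ E`. This `z` is a friend of `e` and of everything in
`avoid D y` outside `E`, while `e` is a friend of `y`. If `E` is a point, `z` serves throughout.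
Otherwise the part outside `E` is played first with friend `z`, then `y` with friend `e`, then `E`
by induction; the move `y` makes up for the lost `+ 1`. -/
theorem otype_le_frank_add_one {D Y : Set X} (hD : SumIndecomposable D) (hnt : D.Nontrivial)
    (hY : Y ⊆ D) : otype Y ≤ frank D Y + 1 := by
  induction hd : otype D using WellFoundedLT.induction generalizing D Y with
  | ind d ih =>
    subst hd
    rw [otype_le_iff]
    intro y hy
    rw [Order.lt_add_one_iff]
    rcases (avoid D y).eq_empty_or_nonempty with hemp | hne
    · have : avoid Y y = ∅ := subset_empty_iff.1 (hemp ▸ avoid_mono hY y)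
      rw [this, otype_empty]
      exact zero_le
    obtain ⟨E, hE, hEne, hEind⟩ := exists_least_cut hne
    obtain ⟨z, hz, hyz, e, he, hez⟩ : ∃ z ∈ D, y ≤ z ∧ ∃ e ∈ E, ¬ e < z := by
      by_contra! hcon
      have hcut : IsCut D E := by
        refine ⟨hE.subset.trans inter_subset_left, fun a ha b hb hbE => ?_⟩
        by_cases hyb : y ≤ b
        · exact hcon b hb hyb a ha
        · exact hE.lt a ha b ⟨hb, hyb⟩ hbE
      exact (hE.subset (hD E hcut hEne ▸ hY hy)).2 le_rfl
    have hye : ¬ y ≤ e := (hE.subset he).2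
    have hze : Incomp z e := ⟨fun h => hye (hyz.trans h), fun h =>
      hez (lt_of_le_of_ne h fun h' => hye (h' ▸ hyz))⟩
    have hey : Incomp e y := ⟨fun h => hze.2 (h.trans hyz), hye⟩
    have hzR : ∀ w ∈ avoid D y, w ∉ E → Incomp z w := fun w hw hwE =>
      ⟨fun h => hw.2 (hyz.trans h), fun h => hez ((hE.lt e he w hw hwE).trans_le h)⟩
    by_cases hEnt : E.Nontrivial
    · have h1 := ih (otype E)
        ((otype_mono hE.subset).trans_lt (otype_avoid_lt (hY hy))) hEind hEnt
        (Y := Y ∩ E) inter_subset_right rfl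
      have h2 : otype (avoid Y y) ≤ otype (Y ∩ E) + otype (avoid Y y \ E) := by
        refine (otype_mono ?_).trans (otype_union_le_add ?_)
        · intro w hw
          by_cases hwE : w ∈ E
          · exact Or.inl ⟨hw.1, hwE⟩
          · exact Or.inr ⟨hw, hwE⟩
        · exact fun a ha b hb => hE.lt a ha.2 b (avoid_mono hY y hb.1) hb.2
      refine h2.trans ((add_le_add_left h1 _).trans ?_)
      have h3 : frank E (Y ∩ E) + 1 ≤
          seqRank FriendlyBad (friendPairs E (Y ∩ E) ∪ {(y, e)}) := by
        refine le_trans (add_le_add_right (Order.one_le_iff_pos.2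
          (seqRank_pos (singleton_nonempty (y, e)))) _) (seqRank_add_le_union ?_)
        rintro p ⟨hp1, hp2, -⟩ q rfl
        exact ⟨(hE.subset hp1.2).2, (hE.subset hp2).2⟩
      have h4 : otype (avoid Y y \ E) ≤
          seqRank FriendlyBad ((fun w => (w, z)) '' (avoid Y y \ E)) :=
        seqRank_le_of_mapsTo (fun w => (w, z)) (fun w hw => ⟨w, hw, rfl⟩) fun a ha b _ hab =>
          ⟨hab, (hzR a (avoid_mono hY y ha.1) ha.2).2⟩
      refine (add_le_add h3 h4).trans ((seqRank_add_le_union ?_).trans (seqRank_mono ?_))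
      · rintro p hp _ ⟨w, hw, rfl⟩
        have hwz := (hzR w (avoid_mono hY y hw.1) hw.2).2
        have hEw : ∀ a ∈ E, ¬ w ≤ a := fun a ha =>
          (hE.lt a ha w (avoid_mono hY y hw.1) hw.2).not_ge
        rcases hp with hp | rfl
        · exact ⟨hEw _ hp.1.2, hEw _ hp.2.1⟩
        · exact ⟨fun h => hwz (h.trans hyz), hEw _ he⟩
      · refine union_subset (union_subset ?_ ?_) ?_
        · exact friendPairs_mono (hE.subset.trans inter_subset_left) inter_subset_left
        · rintro _ rfl
          exact ⟨hy, (hE.subset he).1, hey⟩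
        · rintro _ ⟨w, hw, rfl⟩
          exact ⟨hw.1.1, hz, hzR w (avoid_mono hY y hw.1) hw.2⟩
    · rw [not_nontrivial_iff] at hEnt
      have hzD : ∀ w ∈ avoid Y y, Incomp z w := fun w hw => by
        by_cases hwE : w ∈ E
        · rwa [hEnt hwE he]
        · exact hzR w (avoid_mono hY y hw) hwE
      exact seqRank_le_of_mapsTo (fun w => (w, z)) (fun w hw => ⟨hw.1, hz, hzD w hw⟩)
        fun a ha b _ hab => ⟨hab, (hzD a ha).2⟩

/-- `Y` has maximal order type and friendly rank (relative to `D`) equal to the friendly rank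
of `D`. -/
structure IsFriendlyCore (D Y : Set X) : Prop where
  subset : Y ⊆ D
  otype_le : otype Y ≤ frank D D
  le_frank : frank D D ≤ frank D Y

/-- For successor rank, a first friendly move is added to a core of its residual. For limit rank,
`D` itself works unless its order type is too large by one; then some `avoid D y` has the right
type, and a smaller friendly rank of it, plus one, would still be below the limit. -/
theorem IsFriendlyCore.exists_of_sumIndecomposable {D : Set X} (hD : SumIndecomposable D)
    (ih : ∀ D' : Set X, frank D' D' < frank D D → ∃ Y, IsFriendlyCore D' Y) :
    ∃ Y, IsFriendlyCore D Y := by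
  rcases Ordinal.zero_or_succ_or_isSuccLimit (frank D D) with h0 | ⟨b, hb⟩ | hlim
  · exact ⟨∅, empty_subset _, by rw [otype_empty]; exact zero_le, by rw [h0]; exact zero_le⟩
  · obtain ⟨x, hx, ⟨z, hz, hzx⟩, hbx⟩ := lt_frank_iff.1 (hb ▸ Order.lt_succ b)
    have hlt := frank_avoid_lt hx hz hzx
    obtain ⟨Y, hY, hY1, hY2⟩ := ih _ hlt
    refine ⟨insert x Y, insert_subset hx (hY.trans inter_subset_left), ?_, ?_⟩
    · rw [← hb, Order.lt_succ_iff] at hlt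
      rw [← hb, Order.succ_eq_add_one]
      refine (seqRank_insert_le Y x fun h => h le_rfl).trans ?_
      exact add_le_add_left (hY1.trans hlt) 1
    · rw [← hb, Order.succ_le_iff, lt_frank_iff]
      refine ⟨x, mem_insert _ _, ⟨z, hz, hzx⟩, hbx.trans (hY2.trans (frank_mono subset_rfl ?_))⟩
      exact fun w hw => ⟨mem_insert_of_mem _ hw, (hY hw).2⟩
  · have hnt : D.Nontrivial := by
      obtain ⟨x, hx, ⟨z, hz, hzx⟩, -⟩ := lt_frank_iff.1 hlim.bot_lt
      exact ⟨x, hx, z, hz, fun h => hzx.1 (h ▸ le_rfl)⟩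
    have hle := otype_le_frank_add_one hD hnt subset_rfl
    rcases le_or_gt (otype D) (frank D D) with h | h
    · exact ⟨D, subset_rfl, h, le_rfl⟩
    · obtain ⟨y, hy, hle'⟩ := lt_otype_iff.1 h
      refine ⟨avoid D y, inter_subset_left, ?_, ?_⟩
      · exact Order.lt_add_one_iff.1 ((otype_avoid_lt hy).trans_le hle)
      · by_contra! hlt
        exact ((hle'.trans (otype_le_frank_add_one hD hnt inter_subset_left)).trans_lt
          (hlim.succ_lt hlt)).false

/-- The union of the cores of the summands works. A move `x` in a cut leaves only `cutLT D x` and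
part of `summand D x`, so both ranks are compared by additivity over ordinal sums and induction on
cuts. -/
theorem IsFriendlyCore.exists_of_summand {D : Set X}
    (h : ∀ x ∈ D, ∃ Y, IsFriendlyCore (_root_.summand D x) Y) : ∃ Y, IsFriendlyCore D Y := by
  -- The core is chosen as a function of the set, so that points of one summand share it.
  have : ∀ E : Set X, ∃ Y, (∃ Y', IsFriendlyCore E Y') → IsFriendlyCore E Y := fun E => by
    by_cases hE : ∃ Y', IsFriendlyCore E Y'
    · exact hE.imp fun _ h _ => h
    · exact ⟨∅, fun h => absurd h hE⟩
  choose F hF using this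
  set Y : Set X := {x | x ∈ D ∧ x ∈ F (_root_.summand D x)} with hYdef
  have hF' : ∀ x ∈ D, IsFriendlyCore (_root_.summand D x) (F (_root_.summand D x)) :=
    fun x hx => hF _ (h x hx)
  have hYE : ∀ x ∈ D, Y ∩ _root_.summand D x = F (_root_.summand D x) := by
    intro x hx
    ext w
    constructor
    · rintro ⟨hw, hwE⟩
      rw [← summand_eq_of_mem hx hwE]
      exact hw.2
    · intro hw
      have hwE := (hF' x hx).subset hw
      refine ⟨⟨summand_subset hx hwE, ?_⟩, hwE⟩
      rwa [summand_eq_of_mem hx hwE]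
  have key : ∀ A, IsCut D A → otype (Y ∩ A) ≤ frank A A ∧ frank A A ≤ frank A (Y ∩ A) := by
    intro A
    induction hd : otype A using WellFoundedLT.induction generalizing A with
    | ind d ih =>
      subst hd
      intro hA
      have hlow : ∀ x ∈ A, otype (Y ∩ cutLT D x) ≤ frank (cutLT D x) (cutLT D x) ∧
          frank (cutLT D x) (cutLT D x) ≤ frank (cutLT D x) (Y ∩ cutLT D x) := by
        intro x hx
        refine ih _ (seqRank_lt_of_subset_residual hx fun a ha => ⟨?_, ?_⟩) _ rfl
          (IsCut.cutLT D x)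
        · exact cutLT_subset_cutGE D x ha A hA hx
        · exact (lt_of_mem_cutLT (hA.subset hx) ha (mem_summand_self D x)).not_ge
      have hKA : ∀ x ∈ A, cutLT D x ∪ _root_.summand D x ⊆ A := fun x hx => by
        rw [cutLT_union_summand]
        exact fun w hw => hw A hA hx
      have hmem : ∀ x ∈ A, ∀ w ∈ A, ¬ x < w → w ∈ cutLT D x ∪ _root_.summand D x := by
        intro x hx w hw hxw
        rw [cutLT_union_summand]
        by_contra hwK
        exact hxw ((IsCut.cutGE (hA.subset hx)).lt x (mem_cutGE_self D x) w (hA.subset hw) hwK)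
      constructor
      · rw [otype_le_iff]
        rintro x ⟨hxY, hx⟩
        have hxD := hA.subset hx
        calc otype (avoid (Y ∩ A) x)
            ≤ otype ((Y ∩ cutLT D x) ∪ avoid (Y ∩ _root_.summand D x) x) := by
              refine otype_mono ?_
              rintro w ⟨⟨hwY, hwA⟩, hxw⟩
              rcases hmem x hx w hwA fun h => hxw h.le with hw | hw
              · exact Or.inl ⟨hwY, hw⟩
              · exact Or.inr ⟨⟨hwY, hw⟩, hxw⟩
          _ ≤ otype (Y ∩ cutLT D x) + otype (avoid (Y ∩ _root_.summand D x) x) :=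
              otype_union_le_add fun a ha b hb => lt_of_mem_cutLT hxD ha.2 hb.1.2
          _ < otype (Y ∩ cutLT D x) + otype (Y ∩ _root_.summand D x) :=
              add_lt_add_right (otype_avoid_lt
                (show x ∈ Y ∩ _root_.summand D x from ⟨hxY, mem_summand_self D x⟩)) _
          _ ≤ frank (cutLT D x) (cutLT D x) +
                frank (_root_.summand D x) (_root_.summand D x) := by
              refine add_le_add (hlow x hx).1 ?_
              rw [hYE x hxD]
              exact (hF' x hxD).otype_le
          _ ≤ frank (cutLT D x ∪ _root_.summand D x) (cutLT D x ∪ _root_.summand D x) :=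
              frank_add_le_union fun a ha b hb =>
                (lt_of_mem_cutLT hxD (ha.elim id id) hb).not_ge
          _ ≤ frank A A := frank_mono (hKA x hx) (hKA x hx)
      · refine le_of_forall_lt fun c hc => ?_
        obtain ⟨x, hx, ⟨z, hz, hzx⟩, hcx⟩ := lt_frank_iff.1 hc
        have hxD := hA.subset hx
        have hsub : avoid A x ⊆ cutLT D x ∪ avoid (_root_.summand D x) x := by
          rintro w ⟨hwA, hxw⟩
          rcases hmem x hx w hwA fun h => hxw h.le with hw | hw
          · exact Or.inl hw
          · exact Or.inr ⟨hw, hxw⟩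
        have hzE : z ∈ _root_.summand D x :=
          (hmem x hx z hz fun h => hzx.2 h.le).resolve_left fun h =>
            hzx.1 (lt_of_mem_cutLT hxD h (mem_summand_self D x)).le
        calc c ≤ frank (avoid A x) (avoid A x) := hcx
          _ ≤ frank (cutLT D x ∪ avoid (_root_.summand D x) x)
                (cutLT D x ∪ avoid (_root_.summand D x) x) := frank_mono hsub hsub
          _ ≤ frank (cutLT D x) (cutLT D x) +
                frank (avoid (_root_.summand D x) x) (avoid (_root_.summand D x) x) :=
              frank_union_le_add subset_rfl subset_rfl fun a ha b hb =>
                lt_of_mem_cutLT hxD ha hb.1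
          _ < frank (cutLT D x) (cutLT D x) +
                frank (_root_.summand D x) (_root_.summand D x) :=
              add_lt_add_right (frank_avoid_lt (mem_summand_self D x) hzE hzx) _
          _ ≤ frank (cutLT D x) (Y ∩ cutLT D x) +
                frank (_root_.summand D x) (Y ∩ _root_.summand D x) := by
              refine add_le_add (hlow x hx).2 ?_
              rw [hYE x hxD]
              exact (hF' x hxD).le_frank
          _ ≤ frank (cutLT D x ∪ _root_.summand D x)
                ((Y ∩ cutLT D x) ∪ (Y ∩ _root_.summand D x)) :=
              frank_add_le_union fun a ha b hb =>
                (lt_of_mem_cutLT hxD (ha.elim id And.right) hb.2).not_ge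
          _ ≤ frank A (Y ∩ A) := by
              rw [← inter_union_distrib_left]
              exact frank_mono (hKA x hx) (inter_subset_inter_right _ (hKA x hx))
  have hYD : Y ∩ D = Y := inter_eq_left.2 fun x hx => hx.1
  have := key D (IsCut.self D)
  rw [hYD] at this
  exact ⟨Y, fun x hx => hx.1, this.1, this.2⟩

theorem IsFriendlyCore.exists (D : Set X) : ∃ Y, IsFriendlyCore D Y := by
  induction hd : frank D D using WellFoundedLT.induction generalizing D with
  | ind d ih =>
    subst hd
    refine exists_of_summand fun x hx => ?_
    have hsub := summand_subset hx
    rcases (frank_mono hsub hsub).lt_or_eq with h | h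
    · exact ih _ h _ rfl
    · refine exists_of_sumIndecomposable (SumIndecomposable.summand hx) fun D' hD' => ?_
      exact ih _ (hD'.trans_eq h) D' rfl

theorem maxSafeOrderType_eq_frank : maxSafeOrderType X = frank (univ : Set X) univ := by
  apply le_antisymm
  · exact Ordinal.iSup_le fun S => maxOrderType_le_frank_of_isSafe S.2
  · obtain ⟨Y, -, hY1, hY2⟩ := IsFriendlyCore.exists (univ : Set X)
    obtain ⟨S, hSY, ρ, hρ, hle⟩ := exists_safeLin _ _ _ hY2
    have hS : IsSafe S :=
      isSafe_of_safeLin hρ ((otype_mono hSY).trans (hY1.trans hle))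
    calc frank (univ : Set X) univ ≤ seqRank (Descends ρ) S := hle
      _ ≤ otype S := seqRank_descends_le_otype hρ.mono
      _ = maxOrderType S := (maxOrderType_coe S).symm
      _ ≤ maxSafeOrderType X :=
        Ordinal.le_iSup (fun S : {S : Set X // IsSafe S} => maxOrderType (S : Set X)) ⟨S, hS⟩

end Cuts

/-! ### The width of the multiset ordering -/

section Multisets

namespace MultisetOrdering

open Classical in
theorem le_iff_count {X : Type u} [PartialOrder X] {a b : MultisetOrdering X} :
    a ≤ b ↔ ∀ x, b.toMultiset.count x < a.toMultiset.count x →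
      ∃ y, a.toMultiset.count y < b.toMultiset.count y ∧ x < y := by
  have h1 : ∀ x, x ∈ a.toMultiset - a.toMultiset ∩ b.toMultiset ↔
      b.toMultiset.count x < a.toMultiset.count x := fun x => by
    rw [← Multiset.count_pos, Multiset.count_sub, Multiset.count_inter]
    omega
  have h2 : ∀ x, x ∈ b.toMultiset - a.toMultiset ∩ b.toMultiset ↔
      a.toMultiset.count x < b.toMultiset.count x := fun x => by
    rw [← Multiset.count_pos, Multiset.count_sub, Multiset.count_inter]
    omega
  constructor
  · rintro (rfl | h) x hx
    · exact absurd hx (lt_irrefl _)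
    · obtain ⟨y, hy, hxy⟩ := h x ((h1 x).2 hx)
      exact ⟨y, (h2 y).1 hy, hxy⟩
  · intro h
    refine Or.inr fun x hx => ?_
    obtain ⟨y, hy, hxy⟩ := h x ((h1 x).1 hx)
    exact ⟨y, (h2 y).2 hy, hxy⟩

theorem add_le_add_left_iff {X : Type u} [PartialOrder X] (c a b : Multiset X) :
    (⟨c + a⟩ : MultisetOrdering X) ≤ ⟨c + b⟩ ↔ (⟨a⟩ : MultisetOrdering X) ≤ ⟨b⟩ := by
  classical
  simp only [le_iff_count, Multiset.count_add, add_lt_add_iff_left]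

end MultisetOrdering

variable {X : Type u} [PartialOrder X]

/-- The multisets with elements in `D`. -/
def multisetsIn (D : Set X) : Set (MultisetOrdering X) := {m | ∀ x ∈ m.toMultiset, x ∈ D}

-- Take `x` maximal among the places where `m` has more copies than `m'` and `m'` has no excess
-- above. If `x` were comparable to all of `D`, every excess of `m'` would lie below `x`, giving `m'
-- ≤ m`.
open Classical in
theorem exists_agreeAbove {D : Set X} {m m' : MultisetOrdering X} (hm : m' ∈ multisetsIn D)
    (h : Incomp m m') : ∃ x ∈ m.toMultiset, (∃ z ∈ D, Incomp z x) ∧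
      m'.toMultiset.count x < m.toMultiset.count x ∧
      ∀ w, x < w → m'.toMultiset.count w = m.toMultiset.count w := by
  have h1 : ¬ m ≤ m' := h.1
  rw [MultisetOrdering.le_iff_count] at h1
  push Not at h1
  obtain ⟨x₀, hx₀, hx₀'⟩ := h1
  obtain ⟨x, hx, ⟨hlt, hle⟩, hmax⟩ := MultisetOrdering.exists_maximal_above m.toMultiset
    (fun x => m'.toMultiset.count x < m.toMultiset.count x ∧
      ∀ y, x < y → m'.toMultiset.count y ≤ m.toMultiset.count y) x₀
    (Multiset.count_pos.1 (by omega))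
    ⟨hx₀, fun y hy => not_lt.1 fun hlt => hx₀' y hlt hy⟩
  refine ⟨x, hx, ?_, hlt, fun w hw => ?_⟩
  · by_contra! hcomp
    refine h.2 (MultisetOrdering.le_iff_count.2 fun w hw => ⟨x, hlt, ?_⟩)
    have hwD := hcomp w (hm w (Multiset.count_pos.1 (by omega)))
    by_contra hwx
    refine hwD ⟨fun hle' => hwx (lt_of_le_of_ne hle' ?_), fun hle' => ?_⟩
    · rintro rfl
      omega
    · rcases hle'.eq_or_lt with rfl | hlt'
      · omega
      · have := hle w hlt'
        omega
  · refine le_antisymm (hle w hw) (not_lt.1 fun hlt' => ?_)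
    exact hmax w (Multiset.count_pos.1 (by omega))
      ⟨hlt', fun y hy => hle y (hw.trans hy)⟩ hw

variable [WellQuasiOrderedLE X]

/-- The width of the multiset ordering on a subset. -/
noncomputable def multisetWidth (D : Set X) : Ordinal.{u} := seqRank Incomp (multisetsIn D)

theorem seqRank_biUnion_lt {α ι : Type*} {R : α → α → Prop} [NoInfiniteSeq R] (s : Finset ι)
    (f : ι → Set α) {e : Ordinal} (h : ∀ i ∈ s, seqRank R (f i) < ω ^ e) :
    seqRank R (⋃ i ∈ s, f i) < ω ^ e := by
  classical
  induction s using Finset.induction_on with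
  | empty =>
    simp only [Finset.notMem_empty, iUnion_of_empty, iUnion_empty, seqRank_empty]
    exact Ordinal.opow_pos _ Ordinal.omega0_pos
  | insert i s _ ih =>
    rw [Finset.set_biUnion_insert]
    exact (seqRank_union_le _ _).trans_lt (natSum_lt_opow (h i (Finset.mem_insert_self _ _))
      (ih fun j hj => h j (Finset.mem_insert_of_mem hj)))

-- All multiplicities at and above `x` are prescribed, so comparisons are decided by the elements
-- not above `x`.
open Classical in
theorem seqRank_agreeAbove_le (D : Set X) (m : Multiset X) (x : X) (k : ℕ) :
    seqRank Incomp {a : MultisetOrdering X | a ∈ multisetsIn D ∧ a.toMultiset.count x = k ∧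
      ∀ w, x < w → a.toMultiset.count w = m.count w} ≤ multisetWidth (avoid D x) := by
  refine seqRank_le_of_mapsTo (fun a => ⟨a.toMultiset.filter (¬ x ≤ ·)⟩) ?_ ?_
  · rintro a ⟨ha, -⟩ w hw
    rw [Multiset.mem_filter] at hw
    exact ⟨ha w hw.1, hw.2⟩
  · have key : ∀ a b : MultisetOrdering X, (a.toMultiset.count x = k ∧
        ∀ w, x < w → a.toMultiset.count w = m.count w) → (b.toMultiset.count x = k ∧
        ∀ w, x < w → b.toMultiset.count w = m.count w) →
        (⟨a.toMultiset.filter (¬ x ≤ ·)⟩ : MultisetOrdering X) ≤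
          ⟨b.toMultiset.filter (¬ x ≤ ·)⟩ → a ≤ b := by
      intro a b ha hb hab
      rw [MultisetOrdering.le_iff_count] at hab ⊢
      intro w hw
      have hxw : ¬ x ≤ w := by
        intro hxw
        rcases hxw.eq_or_lt with rfl | hxw
        · omega
        · rw [ha.2 w hxw, hb.2 w hxw] at hw
          exact lt_irrefl _ hw
      obtain ⟨y, hy, hwy⟩ := hab w (by simpa only [Multiset.count_filter, hxw, not_false_eq_true,
        if_true] using hw)
      refine ⟨y, ?_, hwy⟩
      by_cases hxy : x ≤ y
      · simp [hxy] at hy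
      · simpa only [Multiset.count_filter, hxy, not_false_eq_true, if_true] using hy
    exact fun a ha b hb hab =>
      ⟨fun h => hab.1 (key a b ha.2 hb.2 h), fun h => hab.2 (key b a hb.2 ha.2 h)⟩

theorem multisetWidth_le (D : Set X) : multisetWidth D ≤ ω ^ frank D D := by
  classical
  induction hd : frank D D using WellFoundedLT.induction generalizing D with
  | ind d ih =>
    subst hd
    rw [multisetWidth, seqRank_le_iff]
    intro m hm
    let s : Finset (X × ℕ) :=
      (m.toMultiset.toFinset.filter fun x => ∃ z ∈ D, Incomp z x) ×ˢ
        Finset.range (Multiset.card m.toMultiset)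
    refine (seqRank_mono ?_).trans_lt (seqRank_biUnion_lt s (fun p =>
      {a : MultisetOrdering X | a ∈ multisetsIn D ∧ a.toMultiset.count p.1 = p.2 ∧
        ∀ w, p.1 < w → a.toMultiset.count w = m.toMultiset.count w}) fun p hp => ?_)
    · rintro a ⟨ha, hma⟩
      obtain ⟨x, hx, hfr, hlt, hag⟩ := exists_agreeAbove ha hma
      simp only [mem_iUnion]
      refine ⟨(x, a.toMultiset.count x), ?_, ha, rfl, hag⟩
      simp only [s, Finset.mem_product, Finset.mem_filter, Multiset.mem_toFinset,
        Finset.mem_range]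
      exact ⟨⟨hx, hfr⟩, hlt.trans_le (Multiset.count_le_card _ _)⟩
    · simp only [s, Finset.mem_product, Finset.mem_filter, Multiset.mem_toFinset] at hp
      obtain ⟨⟨hx, z, hz, hzx⟩, -⟩ := hp
      have hlt := frank_avoid_lt (hm _ hx) hz hzx
      refine (seqRank_agreeAbove_le D m.toMultiset p.1 p.2).trans_lt
        ((ih _ hlt _ rfl).trans_lt ?_)
      exact (Ordinal.opow_lt_opow_iff_right Ordinal.one_lt_omega0).2 hlt

/-- The set `V n c` consists of blocks with `j < n` copies of `x`, the top block being played first.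
The offset `c` accumulates the content of earlier blocks. -/
theorem multisetWidth_avoid_mul_le {D : Set X} {x z : X} (hx : x ∈ D) (hz : z ∈ D)
    (hzx : Incomp z x) (n : ℕ) : multisetWidth (avoid D x) * n ≤ multisetWidth D := by
  classical
  let M : Set (Multiset X) := {a | ∀ w ∈ a, w ∈ avoid D x}
  let V : ℕ → Multiset X → Set (MultisetOrdering X) := fun n c =>
    {m | ∃ j < n, ∃ a ∈ M, m = ⟨Multiset.replicate j x + (c + a)⟩}
  have hMadd : ∀ a ∈ M, ∀ b ∈ M, a + b ∈ M := fun a ha b hb w hw =>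
    (Multiset.mem_add.1 hw).elim (ha w) (hb w)
  have hMle : ∀ a ∈ M, ∀ w, x ≤ w → a.count w = 0 := fun a ha w hw =>
    Multiset.count_eq_zero.2 fun h => (ha w h).2 hw
  have hcount : ∀ j a w, w ≠ x → (Multiset.replicate j x + a).count w = a.count w :=
    fun j a w hw => by
      rw [Multiset.count_add, Multiset.count_replicate, if_neg hw.symm, zero_add]
  have hcountx : ∀ j, ∀ a ∈ M, (Multiset.replicate j x + a).count x = j := fun j a ha => by
    rw [Multiset.count_add, Multiset.count_replicate_self, hMle a ha x le_rfl, add_zero]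
  have hzne : z ≠ x := fun h => hzx.1 h.le
  have key : ∀ n : ℕ, ∀ c ∈ M, multisetWidth (avoid D x) * n ≤ seqRank Incomp (V n c) := by
    intro n
    induction n with
    | zero => simp
    | succ n ih =>
      intro c hc
      let A : Set (MultisetOrdering X) :=
        {m | ∃ a ∈ M, m = ⟨Multiset.replicate n x + (c + a)⟩}
      have hA : multisetWidth (avoid D x) ≤ seqRank Incomp A := by
        refine seqRank_le_of_mapsTo
          (fun a => ⟨Multiset.replicate n x + (c + a.toMultiset)⟩)
          (fun a ha => ⟨_, ha, rfl⟩) fun a _ b _ hab => ?_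
        simpa only [Incomp, IncompRel, MultisetOrdering.add_le_add_left_iff] using hab
      have hAV : A ∪ V (n + 1) c = V (n + 1) c :=
        union_eq_right.2 fun m ⟨a, ha, h⟩ => ⟨n, Nat.lt_succ_self n, a, ha, h⟩
      rw [Nat.cast_add, Nat.cast_one, mul_add, mul_one, ← hAV]
      refine (add_le_add_right hA _).trans (add_seqRank_le_of_forall_list fun l hl => ?_)
      -- Adding `b` makes every multiplicity other than that of `x` at least as large as in each
      -- member of `l`, strictly at `z`. Only `x` could then dominate `z`, but it is incomparable to
      -- it.
      let b : Multiset X := {z} + (l.map fun m : MultisetOrdering X => m.toMultiset.filter (¬ x ≤ ·)).sum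
      have hb : b ∈ M := by
        refine hMadd _ (fun w hw => ?_) _ (fun w hw => ?_)
        · rw [Multiset.mem_singleton.1 hw]
          exact ⟨hz, hzx.2⟩
        · have hw' : ∀ l : List (MultisetOrdering X), (∀ m ∈ l, m ∈ A) →
              w ∈ (l.map fun m : MultisetOrdering X => m.toMultiset.filter (¬ x ≤ ·)).sum → w ∈ D ∧ ¬ x ≤ w := by
            intro l
            induction l with
            | nil => simp
            | cons m l ihl =>
              intro hl hw
              rw [List.map_cons, List.sum_cons, Multiset.mem_add, Multiset.mem_filter] at hw
              rcases hw with ⟨hw, hxw⟩ | hw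
              · obtain ⟨a, ha, rfl⟩ := hl m (by simp)
                refine ⟨?_, hxw⟩
                rcases Multiset.mem_add.1 hw with hw | hw
                · rwa [Multiset.eq_of_mem_replicate hw]
                · exact (hMadd _ hc _ ha w hw).1
              · exact ihl (fun m hm => hl m (by simp [hm])) hw
          exact hw' l hl hw
      refine (ih (c + b) (hMadd _ hc _ hb)).trans (seqRank_mono ?_)
      rintro _ ⟨j, hj, a, ha, rfl⟩
      refine ⟨⟨j, hj.trans (Nat.lt_succ_self n), b + a, hMadd _ hb _ ha, by rw [add_assoc c]⟩,
        fun m hm => ?_⟩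
      obtain ⟨a', ha', hma'⟩ := hl m hm
      have hca' := hMadd _ hc _ ha'
      have hcba := hMadd _ (hMadd _ hc _ hb) _ ha
      have hfil : m.toMultiset.filter (¬ x ≤ ·) = c + a' := by
        rw [hma', Multiset.filter_add, Multiset.filter_eq_nil.2, zero_add,
          Multiset.filter_eq_self.2]
        · exact fun w hw => (hca' w hw).2
        · intro w hw
          rw [Multiset.eq_of_mem_replicate hw]
          simp
      have hle : ∀ w, (c + a').count w ≤
          (l.map fun m : MultisetOrdering X => m.toMultiset.filter (¬ x ≤ ·)).sum.count w := fun w => by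
        refine Multiset.count_le_of_le w ?_
        rw [← hfil]
        exact List.single_le_sum (by simp) _ (List.mem_map.2 ⟨m, hm, rfl⟩)
      constructor
      · intro hle'
        rw [MultisetOrdering.le_iff_count] at hle'
        obtain ⟨w, hw, hxw⟩ := hle' x (by
          rw [hma', hcountx _ _ hca', hcountx _ _ hcba]
          exact hj)
        rw [hcount _ _ _ hxw.ne', hMle _ hcba w hxw.le] at hw
        exact absurd hw (Nat.not_lt_zero _)
      · intro hle'
        rw [MultisetOrdering.le_iff_count] at hle'
        obtain ⟨w, hw, hzw⟩ := hle' z (by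
          rw [hma', hcount _ _ _ hzne, hcount _ _ _ hzne]
          have := hle z
          simp only [b, Multiset.count_add, Multiset.count_singleton_self] at this ⊢
          omega)
        have hwx : w ≠ x := fun h => hzx.1 (h ▸ hzw.le)
        rw [hma', hcount _ _ _ hwx, hcount _ _ _ hwx] at hw
        have := hle w
        simp only [b, Multiset.count_add] at this hw
        omega
  refine (key n 0 (by simp [M])).trans (seqRank_mono ?_)
  rintro _ ⟨j, -, a, ha, rfl⟩ w hw
  rcases Multiset.mem_add.1 hw with hw | hw
  · rwa [Multiset.eq_of_mem_replicate hw]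
  · rw [zero_add] at hw
    exact (ha w hw).1

/-- Stacking `n` copies for every `n` turns `ω ^ b` into `ω ^ (b + 1)`; rank zero is covered by the
empty multiset. -/
theorem le_multisetWidth (D : Set X) : ω ^ frank D D ≤ multisetWidth D := by
  induction hd : frank D D using WellFoundedLT.induction generalizing D with
  | ind d ih =>
    subst hd
    have step : ∀ b < frank D D, ω ^ Order.succ b ≤ multisetWidth D := by
      intro b hb
      obtain ⟨x, hx, ⟨z, hz, hzx⟩, hbx⟩ := lt_frank_iff.1 hb
      rw [Ordinal.opow_succ, Ordinal.mul_le_iff_of_isSuccLimit Ordinal.isSuccLimit_omega0]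
      intro c hc
      obtain ⟨n, rfl⟩ := Ordinal.lt_omega0.1 hc
      refine le_trans ?_ (multisetWidth_avoid_mul_le hx hz hzx n)
      gcongr
      exact (Ordinal.opow_le_opow_right Ordinal.omega0_pos hbx).trans
        (ih _ (frank_avoid_lt hx hz hzx) _ rfl)
    rcases Ordinal.zero_or_succ_or_isSuccLimit (frank D D) with h0 | ⟨b, hb⟩ | hlim
    · rw [h0, Ordinal.opow_zero, Order.one_le_iff_pos]
      exact seqRank_pos ⟨⟨0⟩, by simp [multisetsIn]⟩
    · rw [← hb]
      exact step b (hb ▸ Order.lt_succ b)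
    · rw [Ordinal.opow_le_of_isSuccLimit Ordinal.omega0_ne_zero hlim]
      exact fun b hb => (Ordinal.opow_le_opow_right Ordinal.omega0_pos (Order.le_succ b)).trans
        (step b hb)

end Multisets

theorem mainTheorem3 (X : Type u) [PartialOrder X] [WellQuasiOrderedLE X] :
    wpoWidth (MultisetOrdering X) = ω ^ maxSafeOrderType X := by
  have : (univ : Set (MultisetOrdering X)) = multisetsIn univ :=
    (eq_univ_of_forall fun m x _ => mem_univ x).symm
  rw [maxSafeOrderType_eq_frank, wpoWidth_eq_seqRank, this]
  exact le_antisymm (multisetWidth_le univ) (le_multisetWidth univ)
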